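/- Let $n\ge 1$, $0<\theta\le 1$ and $m>0$, and write $L^2=L^2(\mathbf R^n)$, $H^s=H^s(\mathbf R^n)$ for the usual spaces of complex-valued functions. Let $L_\theta=\log(I+(-\Delta)^\theta)$ be the operator in $L^2$ with domain $D(L_\theta)=\{f\in L^2:\ \log(1+|\xi|^{2\theta})\hat f\in L^2\}$ and $L_\theta f=\mathcal F^{-1}\big(\log(1+|\xi|^{2\theta})\hat f\big)$, where $\hat f(\xi)=\mathcal F f(\xi)=\int_{\mathbf R^n}e^{-ix\cdot\xi}f(x)\,dx$; note that $H^1\subset D(L_\theta)$. Consider the Cauchy problem $$u_{tt}-\Delta u+m^2L_\theta u-\Delta u_t=0,\quad t>0,\ x\in\mathbf R^n,\qquad u(0,x)=u_0(x),\quad u_t(0,x)=u_1(x). \tag{P}$$ (i) If $(u_0,u_1)\in D(B):=\{(u,v)\in H^1\times H^1:\ u+v\in H^2\}$, then (P) has a unique solution $u$ in the class $$C^1([0,\infty),H^1)\cap C^2([0,\infty),L^2).$$ Here a function $u$ in this class is called a solution if it satisfies the initial conditions and if, for every $t>0$, the equation holds in the sense of tempered distributions on $\mathbf R^n$, with $u_t(t)$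 and $u_{tt}(t)$ the derivatives of $u$ as an $L^2$-valued function. (ii) If $(u_0,u_1)\in H^1\times L^2$, then (P) has a unique weak solution $u$ in the class $$C([0,\infty),H^1)\cap C^1([0,\infty),L^2).$$ Here a function $u$ in this class is called a weak solution if it satisfies the initial conditions and if, for every Schwartz function $\varphi\in\mathcal S(\mathbf R^n)$, the function $t\mapsto\int_{\mathbf R^n}u_t(t)\varphi\,dx$ is differentiable for $t>0$ with $$\frac{d}{dt}\int_{\mathbf R^n}u_t(t)\,\varphi\,dx=\int_{\mathbf R^n}u(t)\,\Delta\varphi\,dx-m^2\int_{\mathbf R^n}(L_\theta u(t))\,\varphi\,dx+\int_{\mathbf R^n}u_t(t)\,\Delta\varphi\,dx .$$ -/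

import Mathlib

open MeasureTheory Set
open scoped SchwartzMap FourierTransform Laplacian ContDiff

noncomputable section

namespace LogWave

/-- Euclidean space `ℝⁿ`. -/
abbrev Rn (n : ℕ) : Type := EuclideanSpace ℝ (Fin n)

/-- The space `L²(ℝⁿ)` of complex-valued square-integrable functions (modulo null sets). -/
abbrev L2 (n : ℕ) : Type := Lp ℂ 2 (volume : Measure (Rn n))

/-- An element of `L²(ℝⁿ)` regarded as a tempered distribution. -/
abbrev toDist {n : ℕ} (f : L2 n) : 𝓢'(Rn n, ℂ) := Lp.toTemperedDistribution f

/-! ### Sobolev spaces -/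

/-- The Sobolev space `Hˢ(ℝⁿ)`, `s ≥ 0`, as a linear subspace of `L²(ℝⁿ)`:
the `f` with `(1 + |ξ|²)^(s/2) 𝓕f ∈ L²`. -/
def sobolev (n : ℕ) (s : ℝ) : Submodule ℂ (L2 n) where
  carrier := {f | TemperedDistribution.MemSobolev s 2 (toDist f)}
  zero_mem' := by
    have h : toDist (0 : L2 n) = 0 := map_zero (Lp.toTemperedDistributionCLM ℂ volume 2)
    simp [h]
  add_mem' {f g} hf hg := by
    have h : toDist (f + g) = toDist f + toDist g :=
      map_add (Lp.toTemperedDistributionCLM ℂ volume 2) f g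
    simpa only [Set.mem_ofPred_eq, h] using hf.add hg
  smul_mem' c f hf := by
    have h : toDist (c • f) = c • toDist f :=
      map_smul (Lp.toTemperedDistributionCLM ℂ volume 2) c f
    simpa only [Set.mem_ofPred_eq, h] using hf.smul c

lemma toDist_injective (n : ℕ) : Function.Injective (toDist : L2 n → 𝓢'(Rn n, ℂ)) :=
  LinearMap.ker_eq_bot.mp
    (Lp.ker_toTemperedDistributionCLM_eq_bot (F := ℂ) (μ := (volume : Measure (Rn n))) (p := 2))

/-- The space `H¹(ℝⁿ)`, carrying its own norm (defined below) and not the `L²` norm. -/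
def H1 (n : ℕ) : Type := sobolev n 1

namespace H1

variable {n : ℕ}

instance : AddCommGroup (H1 n) := inferInstanceAs (AddCommGroup (sobolev n 1))

instance : Module ℂ (H1 n) := inferInstanceAs (Module ℂ (sobolev n 1))

/-- The inclusion `H¹(ℝⁿ) ⊂ L²(ℝⁿ)`. -/
def toL2 : H1 n →ₗ[ℂ] L2 n := (sobolev n 1).subtype

/-- The map `f ↦ 𝓕⁻¹ ((1 + |ξ|²)^(1/2) 𝓕f)` from `H¹(ℝⁿ)` to `L²(ℝⁿ)`. -/
def bessel : H1 n →ₗ[ℂ] L2 n where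
  toFun f := Classical.choose f.2
  map_add' f g := by
    apply toDist_injective n
    have h : ∀ a b : L2 n, toDist (a + b) = toDist a + toDist b :=
      fun a b => map_add (Lp.toTemperedDistributionCLM ℂ volume 2) a b
    refine (Classical.choose_spec (f + g).2).symm.trans ?_
    refine Eq.trans ?_ (h _ _).symm
    refine Eq.trans ?_ (congrArg₂ (· + ·) (Classical.choose_spec f.2) (Classical.choose_spec g.2))
    rw [← map_add]
    exact congrArg _ (h f.1 g.1)
  map_smul' c f := by
    apply toDist_injective n
    have h : ∀ a : L2 n, toDist (c • a) = c • toDist a :=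
      fun a => map_smul (Lp.toTemperedDistributionCLM ℂ volume 2) c a
    refine (Classical.choose_spec (c • f).2).symm.trans ?_
    refine Eq.trans ?_ (h _).symm
    refine Eq.trans ?_ (congrArg (c • ·) (Classical.choose_spec f.2))
    rw [← map_smul]
    exact congrArg _ (h f.1)

lemma bessel_spec (f : H1 n) :
    TemperedDistribution.besselPotential (Rn n) ℂ 1 (toDist (toL2 f)) = toDist (bessel f) :=
  Classical.choose_spec f.2

lemma bessel_injective : Function.Injective (bessel : H1 n → L2 n) := by
  intro f g h
  apply Subtype.ext
  apply toDist_injective n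
  have hf := (TemperedDistribution.besselPotential_neg_apply_eq_iff 1 _ _).2 (bessel_spec f)
  have hg := (TemperedDistribution.besselPotential_neg_apply_eq_iff 1 _ _).2 (bessel_spec g)
  rw [h] at hf
  exact hf.symm.trans hg

/-- The Hilbert norm `‖f‖_{H¹} = (∫ (1 + |ξ|²) |𝓕f(ξ)|² dξ)^(1/2)`. -/
instance : NormedAddCommGroup (H1 n) :=
  NormedAddCommGroup.induced (H1 n) (L2 n) bessel bessel_injective

instance : NormedSpace ℂ (H1 n) := NormedSpace.induced ℂ (H1 n) (L2 n) bessel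

lemma norm_def (f : H1 n) : ‖f‖ = ‖bessel f‖ := rfl

end H1

/-! ### The logarithmic Laplacian -/

/-- The symbol `log (1 + |η|^(2θ))` at `η = 2πξ`. Mathlib's Fourier transform is
`𝓕f(ξ) = ∫ e^(-2πi x·ξ) f(x) dx`, so that `-Δ` has the symbol `|2πξ|²`. -/
def logSymbol {n : ℕ} (θ : ℝ) (ξ : Rn n) : ℝ :=
  Real.log (1 + (2 * Real.pi * ‖ξ‖) ^ (2 * θ))

/-- The function `ξ ↦ log (1 + |2πξ|^(2θ)) 𝓕f(ξ)`. -/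
def logMul {n : ℕ} (θ : ℝ) (f : L2 n) (ξ : Rn n) : ℂ :=
  (logSymbol θ ξ : ℂ) * (𝓕 f : L2 n) ξ

lemma logMul_add {n : ℕ} (θ : ℝ) (f g : L2 n) :
    logMul θ (f + g) =ᵐ[volume] logMul θ f + logMul θ g := by
  have h : (𝓕 (f + g) : L2 n) = 𝓕 f + 𝓕 g := FourierTransform.fourier_add f g
  filter_upwards [Lp.coeFn_add (𝓕 f : L2 n) (𝓕 g)] with ξ hξ
  simp only [logMul, h, hξ, Pi.add_apply, mul_add]

lemma logMul_smul {n : ℕ} (θ : ℝ) (c : ℂ) (f : L2 n) :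
    logMul θ (c • f) =ᵐ[volume] c • logMul θ f := by
  have h : (𝓕 (c • f) : L2 n) = c • 𝓕 f := FourierTransform.fourier_smul c f
  filter_upwards [Lp.coeFn_smul c (𝓕 f : L2 n)] with ξ hξ
  simp only [logMul, h, hξ, Pi.smul_apply, smul_eq_mul, mul_left_comm]

/-- The operator `L_θ = log (I + (-Δ)^θ)`, as an unbounded operator in `L²(ℝⁿ)`. Its domain is
the set of `f` with `log (1 + |2πξ|^(2θ)) 𝓕f ∈ L²`, and
`L_θ f = 𝓕⁻¹ (log (1 + |2πξ|^(2θ)) 𝓕f)`. -/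
def logLaplacian (n : ℕ) (θ : ℝ) : L2 n →ₗ.[ℂ] L2 n where
  domain :=
    { carrier := {f | MemLp (logMul θ f) 2 volume}
      zero_mem' := by
        have h := logMul_smul (n := n) θ 0 0
        rw [zero_smul, zero_smul] at h
        exact (memLp_congr_ae h).2 MemLp.zero
      add_mem' := fun {f g} hf hg => (memLp_congr_ae (logMul_add θ f g)).2 (hf.add hg)
      smul_mem' := fun c f hf => (memLp_congr_ae (logMul_smul θ c f)).2 (hf.const_smul c) }
  toFun :=
    { toFun := fun f => 𝓕⁻ (MemLp.toLp (logMul θ f.1) f.2 : L2 n)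
      map_add' := fun f g => by
        rw [← FourierTransform.fourierInv_add]
        congr 1
        exact MemLp.toLp_congr _ (f.2.add g.2) (logMul_add θ f.1 g.1)
      map_smul' := fun c f => by
        rw [RingHom.id_apply, ← FourierTransform.fourierInv_smul]
        congr 1
        exact MemLp.toLp_congr _ (f.2.const_smul c) (logMul_smul θ c f.1) }

/-! ### The Cauchy problem -/

/-- The set of pairs `(u, v) ∈ H¹ × H¹` with `u + v ∈ H²`. -/
def domainB (n : ℕ) : Set (L2 n × L2 n) :=
  {p | p.1 ∈ sobolev n 1 ∧ p.2 ∈ sobolev n 1 ∧ p.1 + p.2 ∈ sobolev n 2}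

variable {n : ℕ}

/-- The time derivative `u_t(t) ∈ L²(ℝⁿ)`, `t ≥ 0` (one-sided at `t = 0`), taken in `L²`. -/
def vel (u : ℝ → H1 n) (t : ℝ) : L2 n := derivWithin (fun s => (u s).toL2) (Ici 0) t

/-- The second time derivative `u_tt(t) ∈ L²(ℝⁿ)`, `t ≥ 0` (one-sided at `t = 0`). -/
def acc (u : ℝ → H1 n) (t : ℝ) : L2 n := derivWithin (vel u) (Ici 0) t

/-- `u ∈ C¹([0,∞), H¹) ∩ C²([0,∞), L²)`. Only the values of `u` on `[0,∞)` matter. -/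
structure StrongClass (u : ℝ → H1 n) : Prop where
  contDiffOn_H1 : ContDiffOn ℝ 1 u (Ici 0)
  contDiffOn_L2 : ContDiffOn ℝ 2 (fun t => (u t).toL2) (Ici 0)

/-- `u ∈ C([0,∞), H¹) ∩ C¹([0,∞), L²)`. Only the values of `u` on `[0,∞)` matter. -/
structure WeakClass (u : ℝ → H1 n) : Prop where
  continuousOn_H1 : ContinuousOn u (Ici 0)
  contDiffOn_L2 : ContDiffOn ℝ 1 (fun t => (u t).toL2) (Ici 0)

/-- `u` solves `u_tt - Δu + m² L_θ u - Δu_t = 0` for `t > 0`, with `u(0) = u₀`, `u_t(0) = u₁`.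
The derivative `u_tt(t)` is that of the `L²`-valued function `u`, and the equation holds between
tempered distributions on `ℝⁿ` for every `t > 0`. -/
structure IsSolution (θ m : ℝ) (u₀ u₁ : L2 n) (u : ℝ → H1 n) : Prop where
  init_pos : (u 0).toL2 = u₀
  init_vel : vel u 0 = u₁
  equation : ∀ t > 0, ∃ h : (u t).toL2 ∈ (logLaplacian n θ).domain,
    toDist (acc u t) - Δ (toDist (u t).toL2) + ((m : ℂ) ^ 2) • toDist (logLaplacian n θ ⟨_, h⟩)
      - Δ (toDist (vel u t)) = 0

/-- `u` is a weak solution of `u_tt - Δu + m² L_θ u - Δu_t = 0`, `u(0) = u₀`, `u_t(0) = u₁`: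
for every test function `φ ∈ 𝓢(ℝⁿ)` the function `t ↦ ∫ u_t(t) φ` is differentiable and
`d/dt ∫ u_t φ = ∫ u Δφ - m² ∫ (L_θ u) φ + ∫ u_t Δφ` for all `t > 0`. -/
structure IsWeakSolution (θ m : ℝ) (u₀ u₁ : L2 n) (u : ℝ → H1 n) : Prop where
  init_pos : (u 0).toL2 = u₀
  init_vel : vel u 0 = u₁
  equation : ∀ t > 0, ∃ h : (u t).toL2 ∈ (logLaplacian n θ).domain, ∀ φ : 𝓢(Rn n, ℂ),
    HasDerivAt (fun s => ∫ x, vel u s x * φ x)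
      ((∫ x, (u t).toL2 x * (Δ φ) x) - (m : ℂ) ^ 2 * (∫ x, logLaplacian n θ ⟨_, h⟩ x * φ x)
        + ∫ x, vel u t x * (Δ φ) x) t

end LogWave

end

open LogWave

noncomputable section

namespace LogWave

variable {n : ℕ}

/-! ### Fourier multipliers on `L2 n` and the Fourier description of Sobolev spaces -/

section Symbols

/-! On the Fourier side the equation decouples: at each frequency `ξ` it is the ordinary
differential equation y'' + a y' + c y = 0 with a = |2πξ|² (`lapSymbol`) and c = a + m² log(1 +
|2πξ|^(2θ)) (`stiffSymbol`). Only two facts about these symbols matter. Both are nonnegative, and c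
lies between |ξ|² and a constant multiple of 1 + |ξ|²; the logarithm is of lower order, bounded by a
multiple of (1 + |ξ|²)^(1/2), which also puts `H1 n` inside the domain of `logLaplacian`.

Existence. The frequency equation is solved by a matrix exponential. Since a ≥ 0, the energy |y'|² +
c|y|² does not increase (`energy_le`), so y' and √c y are bounded for all t ≥ 0 by data that are
square integrable in `ξ`. These bounds are the dominating functions which turn pointwise continuity
and differentiability in t into the same properties in `L2 n` (`continuousOn_L2_of_dominated`,
`hasDerivWithinAt_L2_of_dominated`). The expression for y'' contains symbols of size |ξ|², so it is
only controlled after multiplication by (1 + |ξ|²)⁻¹. Nothing is lost by this: the factor can be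
absorbed in the test functions, because multiplication by it is a bijection of Schwartz space
(`weak_equation_iff`).

Regularity. The generator commutes with its flow, so u_t is the solution whose data are u₁ and the
initial acceleration. On the Fourier side the latter is -a(û₀ + û₁) - m² log(1 + |2πξ|^(2θ)) û₀,
which is square integrable because u₀ + u₁ is in H² and u₀ in H¹. Thus u_t is again of the weak
class, and u is of the strong class (`strongClass_solutionCurve`).

Uniqueness. A weak derivative that is continuous in `L2 n` is a norm derivative
(`hasDerivWithinAt_of_weak`). Restricted to a ball of frequencies, the system then becomes a linear
equation with bounded operators, whose solutions are unique; the balls exhaust frequency space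
(`FourierSolution.eqOn`). Strong solutions are weak solutions (`StrongClass.isSolution_iff`), so
their uniqueness follows. -/

lemma toDist_apply (f : L2 n) (φ : 𝓢(Rn n, ℂ)) : toDist f φ = ∫ x, f x * φ x := by
  simp only [toDist, Lp.toTemperedDistribution_apply, smul_eq_mul, mul_comm]

/-- Pairing with a fixed Schwartz function, as a continuous functional on `L²`. -/
def pairL2 (φ : 𝓢(Rn n, ℂ)) : L2 n →L[ℂ] ℂ :=
  (PointwiseConvergenceCLM.evalCLM (RingHom.id ℂ) ℂ φ).comp
    (Lp.toTemperedDistributionCLM ℂ volume 2)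

lemma pairL2_apply (φ : 𝓢(Rn n, ℂ)) (f : L2 n) : pairL2 φ f = toDist f φ := rfl

/-- A bounded measurable real symbol. -/
structure BddSymbol (k : Rn n → ℝ) : Prop where
  measurable : Measurable k
  bounded : ∃ C, ∀ ξ, |k ξ| ≤ C

lemma BddSymbol.memLp {k : Rn n → ℝ} (hk : BddSymbol k) :
    MemLp (fun ξ => (k ξ : ℂ)) ⊤ (volume : Measure (Rn n)) := by
  obtain ⟨C, hC⟩ := hk.bounded
  refine memLp_top_of_bound
    (Complex.measurable_ofReal.comp hk.measurable).aestronglyMeasurable C ?_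
  filter_upwards with ξ
  simpa using hC ξ

/-- Multiplication by a bounded real symbol on `L²`. -/
def mulL2 {k : Rn n → ℝ} (hk : BddSymbol k) : L2 n →L[ℂ] L2 n :=
  (ContinuousLinearMap.mul ℂ ℂ).holderL volume ⊤ 2 2 (hk.memLp.toLp _)

lemma coeFn_mulL2 {k : Rn n → ℝ} (hk : BddSymbol k) (f : L2 n) :
    mulL2 hk f =ᵐ[volume] fun ξ => (k ξ : ℂ) * f ξ := by
  have h := (ContinuousLinearMap.mul ℂ ℂ).coeFn_holder (r := 2) (hk.memLp.toLp _) f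
  filter_upwards [h, hk.memLp.coeFn_toLp] with ξ h1 h2
  refine h1.trans ?_
  simp [h2]

lemma mulL2_mulL2 {k l p : Rn n → ℝ} (hk : BddSymbol k) (hl : BddSymbol l) (hp : BddSymbol p)
    (h : ∀ ξ, k ξ * l ξ = p ξ) (f : L2 n) : mulL2 hk (mulL2 hl f) = mulL2 hp f := by
  apply Lp.ext
  filter_upwards [coeFn_mulL2 hk (mulL2 hl f), coeFn_mulL2 hl f, coeFn_mulL2 hp f] with ξ h1 h2 h3
  rw [h1, h2, h3, ← h ξ]
  push_cast
  ring

/-- Multiplication of the distribution of an `L²` function by a function of temperate growth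
gives an `L²` function exactly when the pointwise product does. -/
lemma smulLeftCLM_toDist_eq_iff {g : Rn n → ℂ} (hg : g.HasTemperateGrowth) (f h : L2 n) :
    TemperedDistribution.smulLeftCLM ℂ g (toDist f) = toDist h ↔
      h =ᵐ[volume] fun ξ => g ξ * f ξ := by
  have hgc : Continuous g := hg.1.continuous
  constructor
  · intro H
    have hf : LocallyIntegrable f volume := (Lp.memLp f).locallyIntegrable (by norm_num)
    have hh : LocallyIntegrable h volume := (Lp.memLp h).locallyIntegrable (by norm_num)
    have hgf : LocallyIntegrable (fun ξ => g ξ * f ξ) volume := by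
      rw [locallyIntegrable_iff] at hf ⊢
      intro K hK
      exact (hf K hK).continuousOn_mul hgc.continuousOn hK
    refine ae_eq_of_integral_contDiff_smul_eq hh hgf ?_
    intro φ hφ hφc
    -- A real bump function, made complex valued, is a Schwartz function, so the distributional
    -- identity may be tested on it.
    have hg₁ : HasCompactSupport (Complex.ofRealCLM ∘ φ) := hφc.comp_left rfl
    have hg₂ : ContDiff ℝ ∞ (Complex.ofRealCLM ∘ φ) := by fun_prop
    have := congrArg (fun T => T (hg₁.toSchwartzMap hg₂)) H
    simp only [TemperedDistribution.smulLeftCLM_apply_apply, toDist_apply,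
      SchwartzMap.smulLeftCLM_apply_apply hg] at this
    simp only [HasCompactSupport.toSchwartzMap_toFun, Function.comp_apply,
      Complex.ofRealCLM_apply, smul_eq_mul] at this
    simp only [Complex.real_smul]
    calc _ = _ := integral_congr_ae (by filter_upwards with x using mul_comm _ _)
      _ = _ := this.symm
      _ = _ := integral_congr_ae (by filter_upwards with x; ring)
  · intro H
    ext φ
    simp only [TemperedDistribution.smulLeftCLM_apply_apply, toDist_apply,
      SchwartzMap.smulLeftCLM_apply_apply hg]
    apply integral_congr_ae
    filter_upwards [H] with x hx
    rw [hx, smul_eq_mul]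
    ring

lemma fourier_toDist (f : L2 n) : 𝓕 (toDist f) = toDist (𝓕 f) :=
  Lp.fourier_toTemperedDistribution_eq f

/-- The weight `(1 + |ξ|²)^(s/2)`. -/
def weight (s : ℝ) (ξ : Rn n) : ℝ := (1 + ‖ξ‖ ^ 2) ^ (s / 2)

lemma weight_temperate (s : ℝ) : (fun ξ : Rn n => (weight s ξ : ℂ)).HasTemperateGrowth := by
  unfold weight
  fun_prop

lemma weight_pos (s : ℝ) (ξ : Rn n) : 0 < weight s ξ := by
  unfold weight; positivity

lemma weight_add (s r : ℝ) (ξ : Rn n) : weight s ξ * weight r ξ = weight (s + r) ξ := by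
  unfold weight
  rw [← Real.rpow_add (by positivity)]
  ring_nf

lemma weight_zero (ξ : Rn n) : weight 0 ξ = 1 := by simp [weight]

lemma weight_two (ξ : Rn n) : weight 2 ξ = 1 + ‖ξ‖ ^ 2 := by simp [weight]

lemma continuous_weight (s : ℝ) : Continuous (weight s : Rn n → ℝ) := by
  unfold weight
  refine Continuous.rpow_const (by fun_prop) fun x => Or.inl (by positivity)

lemma bddSymbol_weight {s : ℝ} (hs : s ≤ 0) : BddSymbol (weight s : Rn n → ℝ) where
  measurable := (continuous_weight s).measurable
  bounded := by
    refine ⟨1, fun ξ => ?_⟩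
    rw [abs_of_pos (weight_pos s ξ)]
    exact Real.rpow_le_one_of_one_le_of_nonpos (by simp) (by linarith)

/-- The Fourier transform is injective on tempered distributions and turns the Bessel potential into
multiplication by `weight s`. -/
lemma besselPotential_toDist_eq_iff (s : ℝ) (f g : L2 n) :
    TemperedDistribution.besselPotential (Rn n) ℂ s (toDist f) = toDist g ↔
      (𝓕 g : L2 n) =ᵐ[volume] fun ξ => (weight s ξ : ℂ) * (𝓕 f : L2 n) ξ := by
  rw [← smulLeftCLM_toDist_eq_iff (weight_temperate s), ← fourier_toDist, ← fourier_toDist]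
  have h := TemperedDistribution.fourier_besselPotential_eq_smulLeftCLM_fourier_apply s (toDist f)
  change _ ↔ TemperedDistribution.smulLeftCLM ℂ (fun x ↦ ((1 + ‖x‖ ^ 2) ^ (s / 2) : ℝ)) _ = _
  rw [← h]
  exact (FourierTransform.fourierEquiv ℂ 𝓢'(Rn n, ℂ)).injective.eq_iff.symm

/-- Membership in `Hˢ` in terms of the Fourier transform. -/
lemma mem_sobolev_iff (s : ℝ) (f : L2 n) :
    f ∈ sobolev n s ↔ ∃ g : L2 n, g =ᵐ[volume] fun ξ => (weight s ξ : ℂ) * (𝓕 f : L2 n) ξ := by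
  constructor
  · rintro ⟨g, hg⟩
    exact ⟨𝓕 g, (besselPotential_toDist_eq_iff s f g).1 hg⟩
  · rintro ⟨g, hg⟩
    refine ⟨𝓕⁻ g, (besselPotential_toDist_eq_iff s f _).2 ?_⟩
    rwa [FourierTransform.fourier_fourierInv_eq]

/-- The Fourier transform on `L²` as a linear isometry. -/
abbrev fourierL2 (n : ℕ) : L2 n ≃ₗᵢ[ℂ] L2 n := Lp.fourierTransformₗᵢ (Rn n) ℂ

lemma fourierL2_apply (f : L2 n) : fourierL2 n f = 𝓕 f := rfl

/-- The norm-preserving map `f ↦ (1 + |ξ|²)^(1/2) 𝓕f` of `H¹` into `L²`. -/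
def hatIsometry (n : ℕ) : H1 n →ₗᵢ[ℂ] L2 n where
  toLinearMap := (fourierL2 n).toLinearEquiv.toLinearMap ∘ₗ H1.bessel
  norm_map' f := (fourierL2 n).norm_map (H1.bessel f)

lemma coeFn_hatIsometry (f : H1 n) :
    hatIsometry n f =ᵐ[volume] fun ξ => (weight 1 ξ : ℂ) * (𝓕 f.toL2 : L2 n) ξ :=
  (besselPotential_toDist_eq_iff 1 _ _).1 (H1.bessel_spec f)

/-- Dividing by the weight keeps a function in `L2 n`, and the inverse transform of the quotient is
the preimage. Continuity and differentiability in `H1 n` thereby reduce to `L2 n`. -/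
lemma hatIsometry_surjective : Function.Surjective (hatIsometry n) := by
  intro g
  set f : L2 n := 𝓕⁻ (mulL2 (bddSymbol_weight (s := -1) (by norm_num)) g) with hf
  have hff : (𝓕 f : L2 n) = mulL2 (bddSymbol_weight (s := -1) (by norm_num)) g := by
    rw [hf, FourierTransform.fourier_fourierInv_eq]
  have hg : g =ᵐ[volume] fun ξ => (weight 1 ξ : ℂ) * (𝓕 f : L2 n) ξ := by
    rw [hff]
    filter_upwards [coeFn_mulL2 (bddSymbol_weight (s := -1) (by norm_num)) g] with ξ h
    rw [h, ← mul_assoc, ← Complex.ofReal_mul, weight_add]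
    norm_num [weight_zero]
  refine ⟨(⟨f, (mem_sobolev_iff 1 f).2 ⟨g, hg⟩⟩ : sobolev n 1), ?_⟩
  apply Lp.ext
  exact (coeFn_hatIsometry _).trans hg.symm

/-- `H¹` identified with `L²` through `f ↦ (1 + |ξ|²)^(1/2) 𝓕f`. -/
def hatH1 (n : ℕ) : H1 n ≃ₗᵢ[ℂ] L2 n :=
  LinearIsometryEquiv.ofSurjective (hatIsometry n) hatIsometry_surjective

/-- The inclusion `H¹ ⊂ L²` on the Fourier side. -/
def unweight (n : ℕ) : L2 n →L[ℂ] L2 n := mulL2 (bddSymbol_weight (s := -1) (by norm_num))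

lemma coeFn_unweight (f : L2 n) : unweight n f =ᵐ[volume] fun ξ => (weight (-1) ξ : ℂ) * f ξ :=
  coeFn_mulL2 _ f

lemma fourier_toL2 (f : H1 n) : (𝓕 f.toL2 : L2 n) = unweight n (hatH1 n f) := by
  apply Lp.ext
  filter_upwards [coeFn_hatIsometry f, coeFn_unweight (hatH1 n f)] with ξ h1 h2
  rw [h2, hatH1, LinearIsometryEquiv.coe_ofSurjective, h1, ← mul_assoc, ← Complex.ofReal_mul, weight_add]
  norm_num [weight_zero]

lemma toL2_eq (f : H1 n) : f.toL2 = (fourierL2 n).symm (unweight n (hatH1 n f)) := by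
  rw [← fourier_toL2, ← fourierL2_apply, LinearIsometryEquiv.symm_apply_apply]

/-! ### Symbols of the equation -/

/-- The symbol of `-Δ`. -/
def lapSymbol (ξ : Rn n) : ℝ := (2 * Real.pi * ‖ξ‖) ^ 2

lemma lapSymbol_nonneg (ξ : Rn n) : 0 ≤ lapSymbol ξ := by unfold lapSymbol; positivity

lemma continuous_lapSymbol : Continuous (lapSymbol : Rn n → ℝ) := by
  unfold lapSymbol; fun_prop

lemma logSymbol_nonneg (θ : ℝ) (ξ : Rn n) : 0 ≤ logSymbol θ ξ :=
  Real.log_nonneg (by linarith [Real.rpow_nonneg (by positivity : 0 ≤ 2 * Real.pi * ‖ξ‖) (2 * θ)])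

lemma continuous_logSymbol {θ : ℝ} (hθ : 0 < θ) : Continuous (logSymbol θ : Rn n → ℝ) := by
  unfold logSymbol
  have h : Continuous fun ξ : Rn n => 1 + (2 * Real.pi * ‖ξ‖) ^ (2 * θ) :=
    continuous_const.add (Continuous.rpow_const (by fun_prop) fun x => Or.inr (by positivity))
  exact h.log fun ξ => by positivity

lemma one_le_weight_one (ξ : Rn n) : 1 ≤ weight 1 ξ :=
  Real.one_le_rpow (by simp) (by norm_num)

lemma weight_one_sq (ξ : Rn n) : weight 1 ξ ^ 2 = 1 + ‖ξ‖ ^ 2 := by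
  rw [sq, weight_add, ← weight_two]; norm_num

lemma norm_le_weight_one (ξ : Rn n) : ‖ξ‖ ≤ weight 1 ξ := by
  have h := weight_one_sq ξ
  have := weight_pos 1 ξ
  nlinarith [norm_nonneg ξ]

lemma weight_one_le (ξ : Rn n) : weight 1 ξ ≤ 1 + ‖ξ‖ := by
  have h := weight_one_sq ξ
  nlinarith [norm_nonneg ξ, weight_pos 1 ξ]

/-- Linear growth is all that is needed. For x = 2π|ξ| ≥ 1, the condition θ ≤ 1 gives 1 + x^(2θ) ≤
(1 + x)², so the logarithm is at most 2x, and 7 exceeds 2π. The constant 16 is a convenient square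
above 14. -/
lemma logSymbol_le {θ : ℝ} (hθ : 0 < θ) (hθ' : θ ≤ 1) (ξ : Rn n) :
    logSymbol θ ξ ≤ 16 * weight 1 ξ := by
  set x := 2 * Real.pi * ‖ξ‖ with hx
  have hx0 : 0 ≤ x := by positivity
  have hw := one_le_weight_one ξ
  have hxw : x ≤ 7 * weight 1 ξ := by
    have := norm_le_weight_one ξ
    have := Real.pi_lt_d2
    nlinarith [norm_nonneg ξ, Real.pi_pos]
  have hlog : logSymbol θ ξ = Real.log (1 + x ^ (2 * θ)) := rfl
  have hp : 0 ≤ x ^ (2 * θ) := Real.rpow_nonneg hx0 _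
  rw [hlog]
  rcases le_total x 1 with h | h
  · have h3 : x ^ (2 * θ) ≤ 1 := Real.rpow_le_one hx0 h (by positivity)
    linarith [Real.log_le_sub_one_of_pos (by linarith : 0 < 1 + x ^ (2 * θ))]
  · have h3 : x ^ (2 * θ) ≤ x ^ (2 : ℝ) := Real.rpow_le_rpow_of_exponent_le h (by linarith)
    rw [Real.rpow_two] at h3
    have h4 : Real.log (1 + x ^ (2 * θ)) ≤ Real.log ((1 + x) ^ 2) :=
      Real.log_le_log (by linarith) (by nlinarith)
    rw [Real.log_pow] at h4
    push_cast at h4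
    linarith [Real.log_le_sub_one_of_pos (by linarith : 0 < 1 + x)]

/-- The symbol of `-Δ + m² L_θ`. -/
def stiffSymbol (θ m : ℝ) (ξ : Rn n) : ℝ := lapSymbol ξ + m ^ 2 * logSymbol θ ξ

lemma stiffSymbol_nonneg (θ m : ℝ) (ξ : Rn n) : 0 ≤ stiffSymbol θ m ξ :=
  add_nonneg (lapSymbol_nonneg ξ) (mul_nonneg (sq_nonneg m) (logSymbol_nonneg θ ξ))

lemma lapSymbol_le_stiffSymbol (θ m : ℝ) (ξ : Rn n) : lapSymbol ξ ≤ stiffSymbol θ m ξ :=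
  le_add_of_nonneg_right (mul_nonneg (sq_nonneg m) (logSymbol_nonneg θ ξ))

lemma continuous_stiffSymbol {θ : ℝ} (hθ : 0 < θ) (m : ℝ) :
    Continuous (stiffSymbol θ m : Rn n → ℝ) :=
  continuous_lapSymbol.add (continuous_const.mul (continuous_logSymbol hθ))

lemma lapSymbol_le (ξ : Rn n) : lapSymbol ξ ≤ 49 * weight 2 ξ := by
  rw [weight_two, lapSymbol, mul_pow]
  have h : (2 * Real.pi) ^ 2 ≤ 49 := by
    have := Real.pi_lt_d2
    nlinarith [Real.pi_pos]
  nlinarith [sq_nonneg ‖ξ‖]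

lemma weight_one_le_weight_two (ξ : Rn n) : weight 1 ξ ≤ weight 2 ξ := by
  have h := weight_one_sq ξ
  rw [weight_two]
  nlinarith [one_le_weight_one ξ]

lemma stiffSymbol_le {θ : ℝ} (hθ : 0 < θ) (hθ' : θ ≤ 1) (m : ℝ) (ξ : Rn n) :
    stiffSymbol θ m ξ ≤ (49 + 16 * m ^ 2) * weight 2 ξ := by
  have h1 := lapSymbol_le ξ
  have h2 := logSymbol_le hθ hθ' ξ
  have h3 := weight_one_le_weight_two ξ
  have h4 : m ^ 2 * logSymbol θ ξ ≤ m ^ 2 * (16 * weight 2 ξ) := by gcongr; linarith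
  unfold stiffSymbol
  linarith

lemma weight_neg_two_mul_le {k C : ℝ} (ξ : Rn n) (h0 : 0 ≤ k) (h : k ≤ C * weight 2 ξ) :
    |weight (-2) ξ * k| ≤ C := by
  have hw : weight (-2) ξ * weight 2 ξ = 1 := by
    rw [weight_add]; norm_num [weight_zero]
  rw [abs_of_nonneg (mul_nonneg (weight_pos _ _).le h0)]
  calc weight (-2) ξ * k ≤ weight (-2) ξ * (C * weight 2 ξ) :=
        mul_le_mul_of_nonneg_left h (weight_pos _ _).le
    _ = C * (weight (-2) ξ * weight 2 ξ) := by ring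
    _ = C := by rw [hw, mul_one]

lemma bddSymbol_lap : BddSymbol fun ξ : Rn n => weight (-2) ξ * lapSymbol ξ where
  measurable := ((continuous_weight _).mul continuous_lapSymbol).measurable
  bounded := ⟨_, fun ξ => weight_neg_two_mul_le ξ (lapSymbol_nonneg ξ) (lapSymbol_le ξ)⟩

lemma bddSymbol_log {θ : ℝ} (hθ : 0 < θ) (hθ' : θ ≤ 1) :
    BddSymbol fun ξ : Rn n => weight (-2) ξ * logSymbol θ ξ where
  measurable := ((continuous_weight _).mul (continuous_logSymbol hθ)).measurable
  bounded := ⟨_, fun ξ => weight_neg_two_mul_le ξ (logSymbol_nonneg θ ξ)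
    ((logSymbol_le hθ hθ' ξ).trans
      (mul_le_mul_of_nonneg_left (weight_one_le_weight_two ξ) (by norm_num)))⟩

lemma bddSymbol_stiff {θ : ℝ} (hθ : 0 < θ) (hθ' : θ ≤ 1) (m : ℝ) :
    BddSymbol fun ξ : Rn n => weight (-2) ξ * stiffSymbol θ m ξ where
  measurable := ((continuous_weight _).mul (continuous_stiffSymbol hθ m)).measurable
  bounded := ⟨_, fun ξ => weight_neg_two_mul_le ξ (stiffSymbol_nonneg θ m ξ)
    (stiffSymbol_le hθ hθ' m ξ)⟩

/-- The symbol of `L_θ` relative to the weight of `H¹` is bounded. -/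
lemma bddSymbol_log_rel {θ : ℝ} (hθ : 0 < θ) (hθ' : θ ≤ 1) :
    BddSymbol fun ξ : Rn n => weight (-1) ξ * logSymbol θ ξ where
  measurable := ((continuous_weight _).mul (continuous_logSymbol hθ)).measurable
  bounded := by
    refine ⟨16, fun ξ => ?_⟩
    have hw : weight (-1) ξ * weight 1 ξ = 1 := by
      rw [weight_add]; norm_num [weight_zero]
    rw [abs_of_nonneg (mul_nonneg (weight_pos _ _).le (logSymbol_nonneg θ ξ))]
    calc weight (-1) ξ * logSymbol θ ξ ≤ weight (-1) ξ * (16 * weight 1 ξ) :=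
          mul_le_mul_of_nonneg_left (logSymbol_le hθ hθ' ξ) (weight_pos _ _).le
      _ = 16 * (weight (-1) ξ * weight 1 ξ) := by ring
      _ = 16 := by rw [hw, mul_one]

lemma H1_toL2_mem_domain {θ : ℝ} (hθ : 0 < θ) (hθ' : θ ≤ 1) (f : H1 n) :
    f.toL2 ∈ (logLaplacian n θ).domain := by
  change MemLp (logMul θ f.toL2) 2 volume
  have h := Lp.memLp (mulL2 (bddSymbol_log_rel hθ hθ') (hatH1 n f))
  refine (memLp_congr_ae ?_).1 h
  have e := fourier_toL2 f
  filter_upwards [coeFn_mulL2 (bddSymbol_log_rel hθ hθ') (hatH1 n f),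
    coeFn_unweight (hatH1 n f)] with ξ h1 h2
  rw [logMul, e, h1, h2]
  push_cast
  ring

lemma coeFn_fourier_logLaplacian (θ : ℝ) (f : (logLaplacian n θ).domain) :
    (𝓕 (logLaplacian n θ f) : L2 n) =ᵐ[volume]
      fun ξ => (logSymbol θ ξ : ℂ) * (𝓕 (f : L2 n) : L2 n) ξ := by
  have h : (𝓕 (logLaplacian n θ f) : L2 n) = MemLp.toLp (logMul θ f.1) f.2 :=
    FourierTransform.fourier_fourierInv_eq _
  rw [h]
  exact MemLp.coeFn_toLp _

/-! ### The weak formulation on the Fourier side -/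

/-- The operator with symbol `(1 + |ξ|²)⁻¹` on the Fourier side. -/
def smoothing (n : ℕ) : L2 n →L[ℂ] L2 n := mulL2 (bddSymbol_weight (s := -2) (by norm_num))

/-- The right-hand side of the equation on the Fourier side, regularized by `smoothing`. -/
def rhs {θ : ℝ} (hθ : 0 < θ) (hθ' : θ ≤ 1) (m : ℝ) (y v : L2 n) : L2 n :=
  -mulL2 (bddSymbol_stiff hθ hθ' m) y - mulL2 bddSymbol_lap v

/-- The test function `𝓕 ((1 + |ξ|²)⁻¹ χ)`. -/
def regTest (χ : 𝓢(Rn n, ℂ)) : 𝓢(Rn n, ℂ) :=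
  𝓕 (SchwartzMap.smulLeftCLM ℂ (fun ξ : Rn n => (weight (-2) ξ : ℂ)) χ)

/-- Multiplication by `weight 2` inverts multiplication by `weight (-2)` on Schwartz functions.
Testing against all `regTest χ` is therefore as strong as testing against all Schwartz functions. -/
lemma regTest_surjective : Function.Surjective (regTest : 𝓢(Rn n, ℂ) → 𝓢(Rn n, ℂ)) := by
  intro φ
  refine ⟨SchwartzMap.smulLeftCLM ℂ (fun ξ : Rn n => (weight 2 ξ : ℂ)) (𝓕⁻ φ), ?_⟩
  have h : SchwartzMap.smulLeftCLM ℂ (fun ξ : Rn n => (weight (-2) ξ : ℂ))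
      (SchwartzMap.smulLeftCLM ℂ (fun ξ : Rn n => (weight 2 ξ : ℂ)) (𝓕⁻ φ)) = 𝓕⁻ φ := by
    ext ξ
    rw [SchwartzMap.smulLeftCLM_apply_apply (weight_temperate _),
      SchwartzMap.smulLeftCLM_apply_apply (weight_temperate _), smul_smul,
      ← Complex.ofReal_mul, weight_add]
    norm_num [weight_zero]
  rw [regTest, h, FourierTransform.fourier_fourierInv_eq]

/-- The Fourier transform and the multiplier pass by transposition from the test function to `f`. -/
lemma toDist_regTest (f : L2 n) (χ : 𝓢(Rn n, ℂ)) :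
    toDist f (regTest χ) = toDist (smoothing n (𝓕 f)) χ := by
  have h : toDist f (regTest χ) = (𝓕 (toDist f)) (SchwartzMap.smulLeftCLM ℂ
    (fun ξ : Rn n => (weight (-2) ξ : ℂ)) χ) := rfl
  rw [h, fourier_toDist, toDist_apply, toDist_apply]
  apply integral_congr_ae
  filter_upwards [coeFn_mulL2 (bddSymbol_weight (s := -2) (by norm_num)) (𝓕 f : L2 n)] with ξ h1
  rw [SchwartzMap.smulLeftCLM_apply_apply (weight_temperate _), smoothing, h1, smul_eq_mul]
  ring

/-- The factor (1 + |ξ|²)⁻¹ in the test function compensates the growth of |2πξ|², so what acts on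
`𝓕 f` is a bounded operator of `L2 n`. -/
lemma toDist_laplacian_regTest (f : L2 n) (χ : 𝓢(Rn n, ℂ)) :
    toDist f (Δ (regTest χ)) = -toDist (mulL2 bddSymbol_lap (𝓕 f)) χ := by
  have hw := weight_temperate (n := n) (-2)
  have hn : (fun ξ : Rn n => Complex.ofReal (‖ξ‖ ^ 2)).HasTemperateGrowth := by fun_prop
  rw [← TemperedDistribution.laplacian_apply_apply,
    TemperedDistribution.laplacian_eq_fourierMultiplierCLM]
  have h : (TemperedDistribution.fourierMultiplierCLM ℂ (fun x : Rn n ↦ Complex.ofReal (‖x‖ ^ 2))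
      (toDist f)) (regTest χ) = toDist (𝓕 f) (SchwartzMap.smulLeftCLM ℂ
        (fun x : Rn n ↦ Complex.ofReal (‖x‖ ^ 2)) (SchwartzMap.smulLeftCLM ℂ
          (fun ξ : Rn n => (weight (-2) ξ : ℂ)) χ)) := by
    rw [TemperedDistribution.fourierMultiplierCLM_apply_apply, regTest,
      FourierTransform.fourierInv_fourier_eq, ← fourier_toDist]
    rfl
  have h' : ∀ (r : ℝ) (T : 𝓢'(Rn n, ℂ)) (φ : 𝓢(Rn n, ℂ)), (r • T) φ = (r : ℂ) * T φ := by
    intro r T φ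
    exact Complex.real_smul
  rw [h', h, toDist_apply, toDist_apply, ← integral_const_mul, ← integral_neg]
  apply integral_congr_ae
  filter_upwards [coeFn_mulL2 bddSymbol_lap (𝓕 f : L2 n)] with ξ h1
  rw [SchwartzMap.smulLeftCLM_apply_apply hn, SchwartzMap.smulLeftCLM_apply_apply hw, h1,
    smul_eq_mul, smul_eq_mul, lapSymbol]
  push_cast
  ring

lemma toDist_logLaplacian_regTest {θ : ℝ} (hθ : 0 < θ) (hθ' : θ ≤ 1)
    (f : (logLaplacian n θ).domain) (χ : 𝓢(Rn n, ℂ)) :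
    toDist (logLaplacian n θ f) (regTest χ) =
      toDist (mulL2 (bddSymbol_log hθ hθ') (𝓕 (f : L2 n))) χ := by
  rw [toDist_regTest]
  congr 2
  apply Lp.ext
  filter_upwards [coeFn_mulL2 (bddSymbol_weight (s := -2) (by norm_num))
      (𝓕 (logLaplacian n θ f) : L2 n), coeFn_fourier_logLaplacian θ f,
    coeFn_mulL2 (bddSymbol_log hθ hθ') (𝓕 (f : L2 n) : L2 n)] with ξ h1 h2 h3
  rw [smoothing, h1, h2, h3]
  push_cast
  ring

lemma mulL2_stiff {θ : ℝ} (hθ : 0 < θ) (hθ' : θ ≤ 1) (m : ℝ) (f : L2 n) :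
    mulL2 (bddSymbol_stiff hθ hθ' m) f =
      mulL2 bddSymbol_lap f + ((m : ℂ) ^ 2) • mulL2 (bddSymbol_log hθ hθ') f := by
  apply Lp.ext
  filter_upwards [coeFn_mulL2 (bddSymbol_stiff hθ hθ' m) f, coeFn_mulL2 bddSymbol_lap f,
    coeFn_mulL2 (bddSymbol_log hθ hθ') f, Lp.coeFn_add (mulL2 bddSymbol_lap f)
      (((m : ℂ) ^ 2) • mulL2 (bddSymbol_log hθ hθ') f),
    Lp.coeFn_smul ((m : ℂ) ^ 2) (mulL2 (bddSymbol_log hθ hθ') f)] with ξ h1 h2 h3 h4 h5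
  rw [h1, h4, Pi.add_apply, h5, Pi.smul_apply, h2, h3, stiffSymbol, smul_eq_mul]
  push_cast
  ring

/-- The right-hand side of the weak equation, tested against `regTest χ`. -/
lemma weak_rhs_eq {θ : ℝ} (hθ : 0 < θ) (hθ' : θ ≤ 1) (m : ℝ) (f : (logLaplacian n θ).domain)
    (g : L2 n) (χ : 𝓢(Rn n, ℂ)) :
    (∫ x, (f : L2 n) x * (Δ (regTest χ)) x)
      - (m : ℂ) ^ 2 * (∫ x, logLaplacian n θ f x * regTest χ x)
      + ∫ x, g x * (Δ (regTest χ)) x = pairL2 χ (rhs hθ hθ' m (𝓕 (f : L2 n)) (𝓕 g)) := by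
  rw [← toDist_apply, ← toDist_apply, ← toDist_apply, toDist_laplacian_regTest,
    toDist_laplacian_regTest, toDist_logLaplacian_regTest hθ hθ', rhs, mulL2_stiff hθ hθ', map_sub,
    map_neg, map_add, map_smul]
  simp only [pairL2_apply, smul_eq_mul]
  ring

variable {θ m : ℝ} {u : ℝ → H1 n}

/-- The weak equation on the Fourier side. -/
lemma weak_equation_iff (hθ : 0 < θ) (hθ' : θ ≤ 1) (m : ℝ) (u : ℝ → H1 n) (t : ℝ) :
    (∃ h : (u t).toL2 ∈ (logLaplacian n θ).domain, ∀ φ : 𝓢(Rn n, ℂ),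
      HasDerivAt (fun s => ∫ x, vel u s x * φ x)
        ((∫ x, (u t).toL2 x * (Δ φ) x) - (m : ℂ) ^ 2 * (∫ x, logLaplacian n θ ⟨_, h⟩ x * φ x)
          + ∫ x, vel u t x * (Δ φ) x) t) ↔
    ∀ χ : 𝓢(Rn n, ℂ), HasDerivAt (fun s => pairL2 χ (smoothing n (𝓕 (vel u s))))
      (pairL2 χ (rhs hθ hθ' m (𝓕 (u t).toL2) (𝓕 (vel u t)))) t := by
  have hd := H1_toL2_mem_domain hθ hθ' (u t)
  have e : ∀ χ : 𝓢(Rn n, ℂ), (fun s => ∫ x, vel u s x * regTest χ x) =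
      fun s => pairL2 χ (smoothing n (𝓕 (vel u s))) := by
    intro χ
    ext s
    rw [← toDist_apply, toDist_regTest, pairL2_apply]
  constructor
  · rintro ⟨h, H⟩ χ
    have := H (regTest χ)
    rwa [e, weak_rhs_eq hθ hθ' m ⟨_, h⟩] at this
  · intro H
    refine ⟨hd, fun φ => ?_⟩
    obtain ⟨χ, rfl⟩ := regTest_surjective φ
    rw [e, weak_rhs_eq hθ hθ' m ⟨_, hd⟩]
    exact H χ

end Symbols

/-! ### Uniqueness by frequency cutoff, and equivalence of the two notions of solution -/

section Uniqueness

lemma hasDerivWithinAt_map {E F : Type*} [NormedAddCommGroup E] [NormedSpace ℂ E]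
    [NormedAddCommGroup F] [NormedSpace ℂ F] (A : E →L[ℂ] F) {f : ℝ → E} {f' : E} {s : Set ℝ}
    {t : ℝ} (h : HasDerivWithinAt f f' s t) :
    HasDerivWithinAt (fun r => A (f r)) (A f') s t :=
  (A.restrictScalars ℝ).hasFDerivAt.comp_hasDerivWithinAt t h

/-- A curve in `L²` with a continuous derivative in the weak sense for `t > 0` has this
derivative in norm. -/
lemma hasDerivWithinAt_of_weak {g r : ℝ → L2 n} (hg : ContinuousOn g (Ici 0))
    (hr : ContinuousOn r (Ici 0))
    (h : ∀ t > 0, ∀ χ : 𝓢(Rn n, ℂ),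
      HasDerivAt (fun s => pairL2 χ (g s)) (pairL2 χ (r t)) t) :
    ∀ t ≥ 0, HasDerivWithinAt g (r t) (Ici 0) t := by
  -- Continuing `r` by the constant `r 0` to negative times makes it continuous on the whole line,
  -- so its primitive is differentiable everywhere.
  set ρ : ℝ → L2 n := fun t => r (max t 0) with hρ
  have hρc : Continuous ρ := by
    have h1 : Continuous fun t : ℝ => max t 0 := by fun_prop
    exact hr.comp_continuous h1 fun t => le_max_right t 0
  have hρr : ∀ t ≥ 0, ρ t = r t := fun t ht => by simp only [hρ, max_eq_left ht]
  set G : ℝ → L2 n := fun t => ∫ s in (0 : ℝ)..t, ρ s with hG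
  have hGd : ∀ t, HasDerivAt G (ρ t) t := fun t =>
    (hρc.integral_hasStrictDerivAt 0 t).hasDerivAt
  have hGc : Continuous G := continuous_iff_continuousAt.2 fun t => (hGd t).continuousAt
  have key : ∀ t ≥ 0, g t = g 0 + G t := by
    have hD : ∀ χ : 𝓢(Rn n, ℂ), ∀ t > 0, HasDerivAt (fun s => pairL2 χ (g s - G s)) 0 t := by
      intro χ t ht
      have h1 := hasDerivWithinAt_map (pairL2 χ) ((hGd t).hasDerivWithinAt (s := univ))
      rw [hasDerivWithinAt_univ, hρr t ht.le] at h1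
      have h2 := (h t ht χ).sub h1
      rw [sub_self] at h2
      refine h2.congr_of_eventuallyEq (Filter.Eventually.of_forall fun s => ?_)
      simp only [map_sub, Pi.sub_apply]
    have hC : ∀ χ : 𝓢(Rn n, ℂ), ContinuousOn (fun s => pairL2 χ (g s - G s)) (Ici 0) :=
      fun χ => (pairL2 χ).continuous.comp_continuousOn (hg.sub hGc.continuousOn)
    have hconst : ∀ χ : 𝓢(Rn n, ℂ), ∀ t > 0,
        pairL2 χ (g t - G t) = pairL2 χ (g 0 - G 0) := by
      intro χ t ht
      -- The weak derivative is known only at positive times. The difference is constant on [ε, t],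
      -- and ε → 0 is taken by continuity at 0.
      have hev : ∀ ε ∈ Ioc 0 t, pairL2 χ (g t - G t) = pairL2 χ (g ε - G ε) := by
        intro ε hε
        exact constant_of_has_deriv_right_zero
          ((hC χ).mono fun s hs => hε.1.le.trans hs.1)
          (fun s hs => (hD χ s (hε.1.trans_le hs.1)).hasDerivWithinAt) t ⟨hε.2, le_rfl⟩
      have hl : Filter.Tendsto (fun s => pairL2 χ (g s - G s)) (nhdsWithin 0 (Ioc 0 t))
          (nhds (pairL2 χ (g 0 - G 0))) :=
        ((hC χ) 0 self_mem_Ici).mono_left (nhdsWithin_mono 0 fun s hs => hs.1.le)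
      have hne : (nhdsWithin (0 : ℝ) (Ioc 0 t)).NeBot := by
        rw [nhdsWithin_Ioc_eq_nhdsGT ht]; infer_instance
      refine tendsto_nhds_unique (tendsto_const_nhds.congr' ?_) hl
      filter_upwards [self_mem_nhdsWithin] with s hs using hev s hs
    intro t ht
    have hG0 : G 0 = 0 := by simp [hG]
    rcases (show (0 : ℝ) ≤ t from ht).eq_or_lt with rfl | ht'
    · rw [hG0, add_zero]
    · have : g t - G t = g 0 - G 0 := by
        apply toDist_injective n
        ext χ
        exact hconst χ t ht'
      rw [hG0, sub_zero] at this
      rw [← this, sub_add_cancel]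
  intro t ht
  have h1 := ((hGd t).const_add (g 0)).hasDerivWithinAt (s := Ici 0)
  rw [hρr t ht] at h1
  exact h1.congr (fun s hs => key s hs) (key t ht)

/-- Solutions of the equation on the Fourier side, `y = 𝓕u` and `v = 𝓕u_t`; the second equation
is regularized by the operator `smoothing`. -/
structure FourierSolution {θ : ℝ} (hθ : 0 < θ) (hθ' : θ ≤ 1) (m : ℝ) (y v : ℝ → L2 n) :
    Prop where
  continuousOn_vel : ContinuousOn v (Ici 0)
  deriv_pos : ∀ t ≥ 0, HasDerivWithinAt y (v t) (Ici 0) t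
  deriv_vel : ∀ t ≥ 0, HasDerivWithinAt (fun s => smoothing n (v s))
    (rhs hθ hθ' m (y t) (v t)) (Ici 0) t

open Classical in
/-- The function `k` cut off outside the ball of radius `R`. -/
def cutoff (R : ℝ) (k : Rn n → ℝ) (ξ : Rn n) : ℝ := if ‖ξ‖ ≤ R then k ξ else 0

lemma bddSymbol_cutoff (R : ℝ) {k : Rn n → ℝ} (hk : Continuous k) : BddSymbol (cutoff R k) where
  measurable := Measurable.ite (measurableSet_le measurable_norm measurable_const)
    hk.measurable measurable_const
  bounded := by
    obtain ⟨C, hC⟩ := (isCompact_closedBall (0 : Rn n) R).exists_bound_of_continuousOn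
      hk.continuousOn
    refine ⟨max C 0, fun ξ => ?_⟩
    unfold cutoff
    split_ifs with h
    · exact (hC ξ (by simpa using h)).trans (le_max_left _ _)
    · simp

lemma weight_two_mul_neg (ξ : Rn n) : weight 2 ξ * weight (-2) ξ = 1 := by
  rw [weight_add]; norm_num [weight_zero]

/-- On |ξ| ≤ R every symbol is bounded, and the factor (1 + |ξ|²)⁻¹ is undone by the truncated
`weight 2`. The truncated pair (y, v) solves a linear equation with a bounded generator, to which
uniqueness for Lipschitz equations applies. -/
lemma FourierSolution.eqOn {θ : ℝ} {hθ : 0 < θ} {hθ' : θ ≤ 1} {m : ℝ} {y v y' v' : ℝ → L2 n}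
    (h : FourierSolution hθ hθ' m y v) (h' : FourierSolution hθ hθ' m y' v')
    (h0 : y 0 = y' 0) (h1 : v 0 = v' 0) : EqOn y y' (Ici 0) := by
  have key : ∀ R : ℝ, ∀ t ≥ 0,
      mulL2 (bddSymbol_cutoff R (continuous_const (y := (1 : ℝ)))) (y t) =
        mulL2 (bddSymbol_cutoff R (continuous_const (y := (1 : ℝ)))) (y' t) := by
    intro R t ht
    set P := mulL2 (bddSymbol_cutoff (n := n) R (continuous_const (y := (1 : ℝ)))) with hP
    set Q := mulL2 (bddSymbol_cutoff (n := n) R (continuous_weight 2)) with hQ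
    set A := mulL2 (bddSymbol_cutoff (n := n) R (continuous_stiffSymbol hθ m)) with hA
    set B := mulL2 (bddSymbol_cutoff (n := n) R continuous_lapSymbol) with hB
    have hQs : ∀ f : L2 n, Q (smoothing n f) = P f := fun f =>
      mulL2_mulL2 _ _ _ (fun ξ => by
        have := weight_two_mul_neg ξ
        simp only [cutoff]; split_ifs <;> simp [this]) f
    have hQk : ∀ {k : Rn n → ℝ} (hk : Continuous k)
        (hb : BddSymbol fun ξ : Rn n => weight (-2) ξ * k ξ) (f : L2 n),
        Q (mulL2 hb f) = mulL2 (bddSymbol_cutoff R hk) (P f) := by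
      intro k hk hb f
      have e1 : Q (mulL2 hb f) = mulL2 (bddSymbol_cutoff R hk) f :=
        mulL2_mulL2 _ _ _ (fun ξ => by
          have := weight_two_mul_neg ξ
          simp only [cutoff]; split_ifs
          · rw [← mul_assoc, this, one_mul]
          · simp) f
      have e2 : mulL2 (bddSymbol_cutoff R hk) (P f) = mulL2 (bddSymbol_cutoff R hk) f :=
        mulL2_mulL2 _ _ _ (fun ξ => by simp only [cutoff]; split_ifs <;> simp) f
      rw [e1, e2]
    have hQA := hQk (continuous_stiffSymbol hθ m) (bddSymbol_stiff hθ hθ' m)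
    have hQB := hQk continuous_lapSymbol bddSymbol_lap
    set L : (L2 n × L2 n) →L[ℂ] (L2 n × L2 n) :=
      (ContinuousLinearMap.snd ℂ (L2 n) (L2 n)).prod
        (-(A.comp (ContinuousLinearMap.fst ℂ (L2 n) (L2 n)))
          - B.comp (ContinuousLinearMap.snd ℂ (L2 n) (L2 n))) with hL
    have hode : ∀ {z w : ℝ → L2 n}, FourierSolution hθ hθ' m z w → ∀ t ≥ 0,
        HasDerivWithinAt (fun s => (P (z s), P (w s))) (L (P (z t), P (w t))) (Ici 0) t := by
      intro z w hz t ht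
      have d1 := hasDerivWithinAt_map P (hz.deriv_pos t ht)
      have d2 := hasDerivWithinAt_map Q (hz.deriv_vel t ht)
      simp only [hQs] at d2
      rw [rhs, map_sub, map_neg, hQA, hQB] at d2
      exact d1.prodMk d2
    have hu := ODE_solution_unique (v := fun _ => L) (K := ‖L‖₊) (a := 0) (b := t)
      (f := fun s => (P (y s), P (v s))) (g := fun s => (P (y' s), P (v' s)))
      (fun _ => L.lipschitz)
      (fun s hs => ((hode h s hs.1).continuousWithinAt).mono fun r hr => hr.1)
      (fun s hs => (hode h s hs.1).mono fun r hr => hs.1.trans hr)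
      (fun s hs => ((hode h' s hs.1).continuousWithinAt).mono fun r hr => hr.1)
      (fun s hs => (hode h' s hs.1).mono fun r hr => hs.1.trans hr)
      (by simp only [h0, h1])
    exact congrArg Prod.fst (hu ⟨ht, le_rfl⟩)
  intro t ht
  apply Lp.ext
  -- Integer radii suffice to cover all frequencies, and countably many exceptional null sets form a
  -- null set.
  have hall : ∀ᵐ ξ : Rn n, ∀ N : ℕ, (cutoff N (fun _ => (1 : ℝ)) ξ : ℂ) * y t ξ =
      (cutoff N (fun _ => (1 : ℝ)) ξ : ℂ) * y' t ξ := by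
    rw [ae_all_iff]
    intro N
    have hN := key N t ht
    filter_upwards [coeFn_mulL2 (bddSymbol_cutoff (n := n) N (continuous_const (y := (1 : ℝ))))
      (y t), coeFn_mulL2 (bddSymbol_cutoff (n := n) N (continuous_const (y := (1 : ℝ))))
      (y' t)] with ξ e1 e2
    rw [← e1, ← e2, hN]
  filter_upwards [hall] with ξ hξ
  obtain ⟨N, hN⟩ := exists_nat_ge ‖ξ‖
  simpa [cutoff, hN] using hξ N

/-! ### Solutions and their Fourier transforms -/

variable {θ m : ℝ} {u : ℝ → H1 n} {u₀ u₁ : L2 n}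

lemma WeakClass.hasDerivWithinAt (hu : WeakClass u) {t : ℝ} (ht : 0 ≤ t) :
    HasDerivWithinAt (fun s => (u s).toL2) (vel u t) (Ici 0) t :=
  (((contDiffOn_one_iff_derivWithin (uniqueDiffOn_Ici 0)).1 hu.contDiffOn_L2).1 t
    ht).hasDerivWithinAt

lemma WeakClass.continuousOn_vel (hu : WeakClass u) : ContinuousOn (vel u) (Ici 0) :=
  ((contDiffOn_one_iff_derivWithin (uniqueDiffOn_Ici 0)).1 hu.contDiffOn_L2).2

lemma StrongClass.weakClass (hu : StrongClass u) : WeakClass u where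
  continuousOn_H1 := hu.contDiffOn_H1.continuousOn
  contDiffOn_L2 := hu.contDiffOn_L2.of_le (by norm_num)

lemma StrongClass.hasDerivWithinAt_vel (hu : StrongClass u) {t : ℝ} (ht : 0 ≤ t) :
    HasDerivWithinAt (vel u) (acc u t) (Ici 0) t := by
  have h2 : ContDiffOn ℝ (1 + 1) (fun t => (u t).toL2) (Ici 0) := by
    convert hu.contDiffOn_L2 using 1; norm_num
  have h := ((contDiffOn_succ_iff_derivWithin (uniqueDiffOn_Ici 0)).1 h2).2.2
  exact ((h.differentiableOn (by norm_num)) t ht).hasDerivWithinAt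

lemma vel_eq_of_hasDerivWithinAt {f' : L2 n} {t : ℝ} (ht : 0 ≤ t)
    (h : HasDerivWithinAt (fun s => (u s).toL2) f' (Ici 0) t) : vel u t = f' :=
  h.derivWithin (uniqueDiffOn_Ici 0 t ht)

lemma continuous_rhs (hθ : 0 < θ) (hθ' : θ ≤ 1) (m : ℝ) {y v : ℝ → L2 n} {s : Set ℝ}
    (hy : ContinuousOn y s) (hv : ContinuousOn v s) :
    ContinuousOn (fun t => rhs hθ hθ' m (y t) (v t)) s :=
  ((mulL2 (bddSymbol_stiff hθ hθ' m)).continuous.comp_continuousOn hy).neg.sub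
    ((mulL2 bddSymbol_lap).continuous.comp_continuousOn hv)

/-- Both the regularized velocity and the right-hand side are continuous in `L2 n` up to t = 0, so
the weak identity for t > 0 upgrades to a norm derivative on [0, ∞). -/
lemma IsWeakSolution.fourierSolution (hθ : 0 < θ) (hθ' : θ ≤ 1) (hu : WeakClass u)
    (h : IsWeakSolution θ m u₀ u₁ u) :
    FourierSolution hθ hθ' m (fun t => 𝓕 (u t).toL2) (fun t => 𝓕 (vel u t)) := by
  have hF : Continuous fun f : L2 n => (𝓕 f : L2 n) := (fourierL2 n).continuous
  have hv : ContinuousOn (fun t => (𝓕 (vel u t) : L2 n)) (Ici 0) :=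
    hF.comp_continuousOn hu.continuousOn_vel
  have hy : ContinuousOn (fun t => (𝓕 (u t).toL2 : L2 n)) (Ici 0) :=
    hF.comp_continuousOn hu.contDiffOn_L2.continuousOn
  refine ⟨hv, fun t ht => ?_, ?_⟩
  · exact hasDerivWithinAt_map
      (fourierL2 n).toContinuousLinearEquiv.toContinuousLinearMap (hu.hasDerivWithinAt ht)
  · exact hasDerivWithinAt_of_weak ((smoothing n).continuous.comp_continuousOn hv)
      (continuous_rhs hθ hθ' m hy hv)
      fun t ht => (weak_equation_iff hθ hθ' m u t).1 (h.equation t ht)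

lemma IsWeakSolution.of_fourierSolution (hθ : 0 < θ) (hθ' : θ ≤ 1)
    (h0 : (u 0).toL2 = u₀) (h1 : vel u 0 = u₁)
    (h : FourierSolution hθ hθ' m (fun t => 𝓕 (u t).toL2) (fun t => 𝓕 (vel u t))) :
    IsWeakSolution θ m u₀ u₁ u where
  init_pos := h0
  init_vel := h1
  equation t ht := (weak_equation_iff hθ hθ' m u t).2 fun χ =>
    (hasDerivWithinAt_map (pairL2 χ) (h.deriv_vel t ht.le)).hasDerivAt (Ici_mem_nhds ht)

lemma toL2_injective : Function.Injective (H1.toL2 : H1 n → L2 n) := Subtype.val_injective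

/-- Weak solutions are unique. -/
theorem weakSolution_unique (hθ : 0 < θ) (hθ' : θ ≤ 1) {w : ℝ → H1 n}
    (hu : WeakClass u) (hu' : IsWeakSolution θ m u₀ u₁ u)
    (hw : WeakClass w) (hw' : IsWeakSolution θ m u₀ u₁ w) : EqOn w u (Ici 0) := by
  have h := (hw'.fourierSolution hθ hθ' hw).eqOn (hu'.fourierSolution hθ hθ' hu)
    (by simp only [hw'.init_pos, hu'.init_pos]) (by simp only [hw'.init_vel, hu'.init_vel])
  intro t ht
  exact toL2_injective ((fourierL2 n).injective (h ht))

/-- For functions of the strong class, solutions and weak solutions agree. -/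
theorem StrongClass.isSolution_iff (hu : StrongClass u) :
    IsSolution θ m u₀ u₁ u ↔ IsWeakSolution θ m u₀ u₁ u := by
  -- As u_tt exists in `L2 n`, the derivative in the weak equation is the pairing with u_tt, and the
  -- two formulations compare the same number with the same right-hand side.
  have hd : ∀ t > 0, ∀ φ : 𝓢(Rn n, ℂ),
      HasDerivAt (fun s => ∫ x, vel u s x * φ x) (toDist (acc u t) φ) t := by
    intro t ht φ
    have h := (hasDerivWithinAt_map (pairL2 φ) (hu.hasDerivWithinAt_vel ht.le)).hasDerivAt (Ici_mem_nhds ht)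
    simpa only [pairL2_apply, toDist_apply] using h
  have heq : ∀ t : ℝ, ∀ h : (u t).toL2 ∈ (logLaplacian n θ).domain, ∀ φ : 𝓢(Rn n, ℂ),
      (toDist (acc u t) - Δ (toDist (u t).toL2) + ((m : ℂ) ^ 2) • toDist (logLaplacian n θ ⟨_, h⟩)
        - Δ (toDist (vel u t))) φ =
      toDist (acc u t) φ - ((∫ x, (u t).toL2 x * (Δ φ) x)
        - (m : ℂ) ^ 2 * (∫ x, logLaplacian n θ ⟨_, h⟩ x * φ x) + ∫ x, vel u t x * (Δ φ) x) := by
    intro t h φ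
    have e : ∀ S T V W : 𝓢'(Rn n, ℂ), ∀ c : ℂ, (S - T + c • V - W) φ = S φ - T φ + c * V φ - W φ :=
      fun _ _ _ _ _ => rfl
    rw [e, TemperedDistribution.laplacian_apply_apply, TemperedDistribution.laplacian_apply_apply,
      ← toDist_apply, ← toDist_apply, ← toDist_apply]
    ring
  constructor
  · rintro ⟨h0, h1, h⟩
    refine ⟨h0, h1, fun t ht => ?_⟩
    obtain ⟨hm, H⟩ := h t ht
    refine ⟨hm, fun φ => ?_⟩
    have e := heq t hm φ
    rw [H] at e
    rw [← sub_eq_zero.1 e.symm]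
    exact hd t ht φ
  · rintro ⟨h0, h1, h⟩
    refine ⟨h0, h1, fun t ht => ?_⟩
    obtain ⟨hm, H⟩ := h t ht
    refine ⟨hm, ?_⟩
    ext φ
    rw [heq t hm φ, (hd t ht φ).unique (H φ), sub_self]
    rfl

end Uniqueness

section Existence

/-! ### Dominated convergence for curves in `L²` -/

lemma L2_norm_sq (f : L2 n) : ‖f‖ ^ 2 = ∫ ξ, ‖f ξ‖ ^ 2 := by
  have h := inner_self_eq_norm_sq_to_K (𝕜 := ℂ) f
  rw [L2.inner_def] at h
  have h2 : (fun ξ => inner ℂ (f ξ) (f ξ)) = fun ξ => (((‖f ξ‖ ^ 2 : ℝ)) : ℂ) := by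
    ext ξ
    rw [inner_self_eq_norm_sq_to_K]
    push_cast
    rfl
  rw [h2] at h
  have h3 : ((∫ ξ, ‖f ξ‖ ^ 2 : ℝ) : ℂ) = ((‖f‖ ^ 2 : ℝ) : ℂ) := by
    rw [Complex.ofReal_pow, ← integral_complex_ofReal]; exact h
  exact (Complex.ofReal_injective h3).symm

/-- Dominated convergence for the squared distance, with majorant 4g². A general filter is allowed
so that the lemma covers both values and difference quotients. -/
lemma tendsto_L2_of_dominated {ι : Type*} {l : Filter ι} [l.IsCountablyGenerated] {f : ι → L2 n}
    {f₀ : L2 n} {F : ι → Rn n → ℂ} {g : Rn n → ℝ} (hg : MemLp g 2 volume)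
    (hF : ∀ᶠ i in l, f i =ᵐ[volume] F i) (hb : ∀ᶠ i in l, ∀ᵐ ξ, ‖F i ξ‖ ≤ g ξ)
    (hb₀ : ∀ᵐ ξ, ‖f₀ ξ‖ ≤ g ξ)
    (hlim : ∀ᵐ ξ, Filter.Tendsto (fun i => F i ξ) l (nhds (f₀ ξ))) :
    Filter.Tendsto f l (nhds f₀) := by
  have h1 : Filter.Tendsto (fun i => ∫ ξ, ‖F i ξ - f₀ ξ‖ ^ 2) l (nhds (∫ _ : Rn n, (0 : ℝ))) := by
    refine tendsto_integral_filter_of_dominated_convergence (fun ξ => 4 * ‖g ξ‖ ^ 2) ?_ ?_ ?_ ?_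
    · filter_upwards [hF] with i hi
      have := (Lp.aestronglyMeasurable (f i)).congr hi
      exact ((this.sub (Lp.aestronglyMeasurable f₀)).norm.pow 2)
    · filter_upwards [hb] with i hi
      filter_upwards [hi, hb₀] with ξ e1 e2
      have e3 : ‖F i ξ - f₀ ξ‖ ≤ 2 * g ξ := (norm_sub_le _ _).trans (by linarith)
      rw [norm_pow, norm_norm, Real.norm_eq_abs, sq_abs]
      nlinarith [norm_nonneg (F i ξ - f₀ ξ)]
    · exact (hg.integrable_norm_pow (p := 2) (by norm_num)).const_mul 4
    · filter_upwards [hlim] with ξ hξ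
      have := (tendsto_iff_norm_sub_tendsto_zero.1 hξ).pow 2
      simpa using this
  rw [integral_zero] at h1
  have h2 : Filter.Tendsto (fun i => ‖f i - f₀‖ ^ 2) l (nhds 0) := by
    refine h1.congr' ?_
    filter_upwards [hF] with i hi
    rw [L2_norm_sq]
    apply integral_congr_ae
    filter_upwards [hi, Lp.coeFn_sub (f i) f₀] with ξ e1 e2
    rw [e2, Pi.sub_apply, e1]
  rw [tendsto_iff_norm_sub_tendsto_zero]
  have h3 := h2.sqrt
  simpa using h3

lemma continuousOn_L2_of_dominated {f : ℝ → L2 n} {F : ℝ → Rn n → ℂ}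
    (hF : ∀ t ≥ 0, f t =ᵐ[volume] F t)
    (hc : ∀ᵐ ξ, ContinuousOn (fun t => F t ξ) (Ici 0))
    (hb : ∀ T, ∃ g : Rn n → ℝ, MemLp g 2 volume ∧ ∀ᵐ ξ, ∀ t ∈ Icc 0 T, ‖F t ξ‖ ≤ g ξ) :
    ContinuousOn f (Ici 0) := by
  intro t ht
  obtain ⟨g, hg, hgb⟩ := hb (t + 1)
  have hev : ∀ᶠ s in nhdsWithin t (Ici 0), s ∈ Icc 0 (t + 1) := by
    filter_upwards [self_mem_nhdsWithin,
      mem_nhdsWithin_of_mem_nhds (Iic_mem_nhds (lt_add_one t))] with s h1 h2 using ⟨h1, h2⟩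
  refine tendsto_L2_of_dominated (F := F) hg ?_ ?_ ?_ ?_
  · filter_upwards [hev] with s hs using hF s hs.1
  · filter_upwards [hev] with s hs
    filter_upwards [hgb] with ξ h using h s hs
  · filter_upwards [hgb, hF t ht] with ξ h e
    rw [e]
    exact h t ⟨ht, by linarith⟩
  · filter_upwards [hc, hF t ht] with ξ h e
    rw [e]
    exact h t ht

/-- By the mean value inequality, a bound for the pointwise time derivative on [0, T] also bounds
the difference quotients there, so these converge in `L2 n`. -/
lemma hasDerivWithinAt_L2_of_dominated {f : ℝ → L2 n} {f' : ℝ → L2 n} {F G : ℝ → Rn n → ℂ}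
    (hF : ∀ t ≥ 0, f t =ᵐ[volume] F t) (hG : ∀ t ≥ 0, f' t =ᵐ[volume] G t)
    (hd : ∀ᵐ ξ, ∀ t ≥ 0, HasDerivWithinAt (fun t => F t ξ) (G t ξ) (Ici 0) t)
    (hb : ∀ T, ∃ g : Rn n → ℝ, MemLp g 2 volume ∧ ∀ᵐ ξ, ∀ t ∈ Icc 0 T, ‖G t ξ‖ ≤ g ξ)
    {t : ℝ} (ht : 0 ≤ t) : HasDerivWithinAt f (f' t) (Ici 0) t := by
  obtain ⟨g, hg, hgb⟩ := hb (t + 1)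
  rw [hasDerivWithinAt_iff_tendsto_slope]
  have hev : ∀ᶠ s in nhdsWithin t (Ici 0 \ {t}), s ∈ Icc 0 (t + 1) ∧ s ≠ t := by
    filter_upwards [self_mem_nhdsWithin,
      mem_nhdsWithin_of_mem_nhds (Iic_mem_nhds (lt_add_one t))] with s h1 h2
      using ⟨⟨h1.1, h2⟩, h1.2⟩
  refine tendsto_L2_of_dominated (F := fun s ξ => slope (fun t => F t ξ) t s) hg ?_ ?_ ?_ ?_
  · filter_upwards [hev] with s hs
    rw [slope_def_module]
    have e0 : ∀ h : L2 n, ((s - t)⁻¹ : ℝ) • h = (((s - t)⁻¹ : ℝ) : ℂ) • h := fun _ => rfl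
    rw [e0]
    filter_upwards [Lp.coeFn_smul (((s - t)⁻¹ : ℝ) : ℂ) (f s - f t), Lp.coeFn_sub (f s) (f t),
      hF s hs.1.1, hF t ht] with ξ e1 e2 e3 e4
    rw [e1, Pi.smul_apply, e2, Pi.sub_apply, e3, e4, slope_def_module]
    rfl
  · filter_upwards [hev] with s hs
    filter_upwards [hgb, hd] with ξ h1 h2
    have h3 := Convex.norm_image_sub_le_of_norm_hasDerivWithin_le (f := fun t => F t ξ)
      (f' := fun t => G t ξ) (s := Icc 0 (t + 1)) (x := t) (y := s) (C := g ξ)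
      (fun r hr => (h2 r hr.1).mono fun x hx => hx.1) (fun r hr => h1 r hr)
      (convex_Icc _ _) ⟨ht, by linarith⟩ hs.1
    rw [slope_def_module, norm_smul, norm_inv]
    have h4 : 0 < ‖s - t‖ := norm_pos_iff.2 (sub_ne_zero.2 hs.2)
    rw [inv_mul_le_iff₀ h4]
    linarith
  · filter_upwards [hgb, hG t ht] with ξ h e
    rw [e]
    exact h t ⟨ht, by linarith⟩
  · filter_upwards [hd, hG t ht] with ξ h e
    rw [e]
    exact hasDerivWithinAt_iff_tendsto_slope.1 (h t ht)

/-! ### The ordinary differential equation at a fixed frequency -/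

/-- The generator of the first order system of `y'' + a y' + c y = 0`. -/
def phaseGen (a c : ℝ) : (ℂ × ℂ) →L[ℝ] (ℂ × ℂ) :=
  (ContinuousLinearMap.snd ℝ ℂ ℂ).prod
    (-(c • ContinuousLinearMap.fst ℝ ℂ ℂ) - a • ContinuousLinearMap.snd ℝ ℂ ℂ)

lemma phaseGen_apply (a c : ℝ) (p : ℂ × ℂ) :
    phaseGen a c p = (p.2, -((c : ℂ) * p.1) - (a : ℂ) * p.2) := by
  simp [phaseGen]

/-- The generator is affine in (a, c); this form makes its continuity in the coefficients visible.
-/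
lemma phaseGen_eq (a c : ℝ) :
    phaseGen a c = phaseGen 0 0 + c • (phaseGen 0 1 - phaseGen 0 0)
      + a • (phaseGen 1 0 - phaseGen 0 0) := by
  ext p <;> simp [phaseGen_apply]

/-- The one-parameter group `t ↦ exp (t x)` in a Banach algebra. -/
def expFlow {A : Type*} [NormedRing A] [NormedAlgebra ℝ A] (x : A) (t : ℝ) : A :=
  NormedSpace.exp (t • x)

section expFlow

variable {A : Type*} [NormedRing A] [NormedAlgebra ℝ A]

lemma expFlow_zero (x : A) : expFlow x 0 = 1 := by simp [expFlow]

lemma expFlow_mul_self (x : A) (t : ℝ) : expFlow x t * x = x * expFlow x t :=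
  ((Commute.refl x).smul_left t).exp_left.eq

lemma hasDerivAt_expFlow [CompleteSpace A] (x : A) (t : ℝ) :
    HasDerivAt (expFlow x) (x * expFlow x t) t := hasDerivAt_exp_smul_const' x t

lemma continuous_expFlow [CompleteSpace A] (t : ℝ) : Continuous fun x : A => expFlow x t := by
  let _ : NormedAlgebra ℚ A := NormedAlgebra.restrictScalars ℚ ℝ A
  exact NormedSpace.exp_continuous.comp (continuous_const_smul t)

end expFlow

/-- The flow of `y'' + a y' + c y = 0` on pairs `(y, y')`. -/
def phaseFlow (t a c : ℝ) : (ℂ × ℂ) →L[ℝ] (ℂ × ℂ) := expFlow (phaseGen a c) t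

lemma phaseFlow_zero (a c : ℝ) (p : ℂ × ℂ) : phaseFlow 0 a c p = p := by
  rw [phaseFlow, expFlow_zero]
  rfl

/-- This is the source of time regularity: the derivative of a trajectory is the trajectory of the
differentiated data. -/
lemma phaseFlow_phaseGen (t a c : ℝ) (p : ℂ × ℂ) :
    phaseFlow t a c (phaseGen a c p) = phaseGen a c (phaseFlow t a c p) :=
  DFunLike.congr_fun (expFlow_mul_self (phaseGen a c) t) p

lemma hasDerivAt_phaseFlow (t a c : ℝ) (p : ℂ × ℂ) :
    HasDerivAt (fun s => phaseFlow s a c p) (phaseGen a c (phaseFlow t a c p)) t :=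
  (ContinuousLinearMap.apply ℝ (ℂ × ℂ) p).hasFDerivAt.comp_hasDerivAt t
    (hasDerivAt_expFlow (phaseGen a c) t)

lemma hasDerivAt_phaseFlow_fst (t a c : ℝ) (p : ℂ × ℂ) :
    HasDerivAt (fun s => (phaseFlow s a c p).1) (phaseFlow t a c p).2 t := by
  have h := (ContinuousLinearMap.fst ℝ ℂ ℂ).hasFDerivAt.comp_hasDerivAt t
    (hasDerivAt_phaseFlow t a c p)
  rw [phaseGen_apply] at h
  exact h

lemma hasDerivAt_phaseFlow_snd (t a c : ℝ) (p : ℂ × ℂ) :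
    HasDerivAt (fun s => (phaseFlow s a c p).2)
      (-((c : ℂ) * (phaseFlow t a c p).1) - (a : ℂ) * (phaseFlow t a c p).2) t := by
  have h := (ContinuousLinearMap.snd ℝ ℂ ℂ).hasFDerivAt.comp_hasDerivAt t
    (hasDerivAt_phaseFlow t a c p)
  rw [phaseGen_apply] at h
  exact h

/-- Used with the frequency as parameter, to make the solution measurable in `ξ`. -/
lemma continuous_phaseFlow {X : Type*} [TopologicalSpace X] (t : ℝ) {a c : X → ℝ}
    (ha : Continuous a) (hc : Continuous c) : Continuous fun x => phaseFlow t (a x) (c x) := by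
  refine (continuous_expFlow t).comp (f := fun x => phaseGen (a x) (c x)) ?_
  have : (fun x => phaseGen (a x) (c x)) = fun x => phaseGen 0 0
      + c x • (phaseGen 0 1 - phaseGen 0 0) + a x • (phaseGen 1 0 - phaseGen 0 0) :=
    funext fun x => phaseGen_eq _ _
  rw [this]
  fun_prop

/-- Decay of the energy `|y'|² + c |y|²`. -/
lemma energy_le {t a c : ℝ} (ht : 0 ≤ t) (ha : 0 ≤ a) (p : ℂ × ℂ) :
    ‖(phaseFlow t a c p).2‖ ^ 2 + c * ‖(phaseFlow t a c p).1‖ ^ 2 ≤ ‖p.2‖ ^ 2 + c * ‖p.1‖ ^ 2 := by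
  set E : ℝ → ℝ := fun s => ‖(phaseFlow s a c p).2‖ ^ 2 + c * ‖(phaseFlow s a c p).1‖ ^ 2 with hE
  -- The cross terms 2c Re⟨y, y'⟩ cancel, and only the damping term remains.
  have hd : ∀ s, HasDerivAt E (-(2 * a) * ‖(phaseFlow s a c p).2‖ ^ 2) s := by
    intro s
    have h1 := (hasDerivAt_phaseFlow_snd s a c p).norm_sq
    have h2 := ((hasDerivAt_phaseFlow_fst s a c p).norm_sq).const_mul c
    refine (h1.add h2).congr_deriv ?_
    simp only [Complex.inner, Complex.sq_norm, Complex.normSq_apply]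
    simp
    ring
  have hanti : AntitoneOn E (Ici 0) := by
    refine antitoneOn_of_deriv_nonpos (convex_Ici 0)
      (fun s _ => (hd s).continuousAt.continuousWithinAt)
      (fun s _ => (hd s).differentiableAt.differentiableWithinAt) fun s _ => ?_
    rw [(hd s).deriv]
    nlinarith [sq_nonneg ‖(phaseFlow s a c p).2‖]
  have := hanti self_mem_Ici ht ht
  simpa only [hE, phaseFlow_zero] using this

lemma norm_snd_le {t a c : ℝ} (ht : 0 ≤ t) (ha : 0 ≤ a) (hc : 0 ≤ c) (p : ℂ × ℂ) :
    ‖(phaseFlow t a c p).2‖ ≤ ‖p.2‖ + √c * ‖p.1‖ := by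
  have h := energy_le (c := c) ht ha p
  have hs := Real.sq_sqrt hc
  refine abs_le_of_sq_le_sq' ?_ (by positivity) |>.2
  nlinarith [mul_nonneg hc (sq_nonneg ‖(phaseFlow t a c p).1‖),
    mul_nonneg (norm_nonneg p.2) (mul_nonneg (Real.sqrt_nonneg c) (norm_nonneg p.1))]

lemma sqrt_mul_norm_fst_le {t a c : ℝ} (ht : 0 ≤ t) (ha : 0 ≤ a) (hc : 0 ≤ c) (p : ℂ × ℂ) :
    √c * ‖(phaseFlow t a c p).1‖ ≤ ‖p.2‖ + √c * ‖p.1‖ := by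
  have h := energy_le (c := c) ht ha p
  have hs := Real.sq_sqrt hc
  refine abs_le_of_sq_le_sq' ?_ (by positivity) |>.2
  rw [mul_pow, hs]
  nlinarith [sq_nonneg ‖(phaseFlow t a c p).2‖,
    mul_nonneg (norm_nonneg p.2) (mul_nonneg (Real.sqrt_nonneg c) (norm_nonneg p.1))]

/-- The energy gives no control of y where c is zero or small, as at low frequencies. Integrating
the velocity bound does, at the price of linear growth in t. -/
lemma norm_fst_le {t a c : ℝ} (ht : 0 ≤ t) (ha : 0 ≤ a) (hc : 0 ≤ c) (p : ℂ × ℂ) :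
    ‖(phaseFlow t a c p).1‖ ≤ ‖p.1‖ + t * (‖p.2‖ + √c * ‖p.1‖) := by
  have h := Convex.norm_image_sub_le_of_norm_hasDerivWithin_le
    (f := fun s => (phaseFlow s a c p).1) (f' := fun s => (phaseFlow s a c p).2)
    (s := Ici 0) (x := 0) (y := t)
    (fun s _ => (hasDerivAt_phaseFlow_fst s a c p).hasDerivWithinAt)
    (fun s hs => norm_snd_le hs ha hc p) (convex_Ici 0) self_mem_Ici ht
  rw [phaseFlow_zero, sub_zero, Real.norm_of_nonneg ht] at h
  have := norm_le_norm_add_norm_sub' (phaseFlow t a c p).1 p.1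
  linarith

/-! ### Existence on the Fourier side -/

variable {θ m : ℝ}

/-- The solution at the frequency `ξ`, as a pair `(y, y')`, for the weighted datum
`(1 + |ξ|²)^(1/2) y(0) = q₀` and `y'(0) = q₁`. -/
def profile (θ m : ℝ) (q₀ q₁ : L2 n) (t : ℝ) (ξ : Rn n) : ℂ × ℂ :=
  phaseFlow t (lapSymbol ξ) (stiffSymbol θ m ξ) ((weight (-1) ξ : ℂ) * q₀ ξ, q₁ ξ)

lemma aestronglyMeasurable_profile (hθ : 0 < θ) (q₀ q₁ : L2 n) (t : ℝ) :
    AEStronglyMeasurable (profile θ m q₀ q₁ t) volume := by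
  have h1 : AEStronglyMeasurable
      (fun ξ : Rn n => phaseFlow t (lapSymbol ξ) (stiffSymbol θ m ξ)) volume :=
    (continuous_phaseFlow t continuous_lapSymbol
      (continuous_stiffSymbol hθ m)).aestronglyMeasurable
  have h2 : AEStronglyMeasurable (fun ξ : Rn n => (weight (-1) ξ : ℂ) * q₀ ξ) volume :=
    (Complex.continuous_ofReal.comp (continuous_weight (-1))).aestronglyMeasurable.mul
      (Lp.aestronglyMeasurable q₀)
  exact (ContinuousLinearMap.id ℝ ((ℂ × ℂ) →L[ℝ] (ℂ × ℂ))).aestronglyMeasurable_comp₂ h1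
    (h2.prodMk (Lp.aestronglyMeasurable q₁))

/-- The square-integrable function dominating the solution. -/
def dominant (m : ℝ) (q₀ q₁ : L2 n) (ξ : Rn n) : ℝ := ‖q₁ ξ‖ + (7 + 4 * |m|) * ‖q₀ ξ‖

lemma memLp_dominant (m : ℝ) (q₀ q₁ : L2 n) : MemLp (dominant m q₀ q₁) 2 volume :=
  (Lp.memLp q₁).norm.add ((Lp.memLp q₀).norm.const_mul _)

/-- The constant comes from 49 + 16m² ≤ (7 + 4|m|)². -/
lemma sqrt_stiffSymbol_le (hθ : 0 < θ) (hθ' : θ ≤ 1) (m : ℝ) (ξ : Rn n) :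
    √(stiffSymbol θ m ξ) ≤ (7 + 4 * |m|) * weight 1 ξ := by
  have hw := weight_pos 1 ξ
  refine Real.sqrt_le_iff.2 ⟨by positivity, (stiffSymbol_le hθ hθ' m ξ).trans ?_⟩
  have e : weight 2 ξ = weight 1 ξ ^ 2 := by rw [sq, weight_add]; norm_num
  rw [mul_pow, e]
  gcongr
  nlinarith [abs_nonneg m, sq_abs m]

lemma weight_mul_neg (ξ : Rn n) : weight 1 ξ * weight (-1) ξ = 1 := by
  rw [weight_add]; norm_num [weight_zero]

/-- √c grows no faster than `weight 1`, so H¹ × L² data have square-integrable energy. -/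
lemma data_le_dominant (hθ : 0 < θ) (hθ' : θ ≤ 1) (m : ℝ) (q₀ q₁ : L2 n) (ξ : Rn n) :
    ‖q₁ ξ‖ + √(stiffSymbol θ m ξ) * ‖(weight (-1) ξ : ℂ) * q₀ ξ‖ ≤ dominant m q₀ q₁ ξ := by
  rw [norm_mul, Complex.norm_real, Real.norm_of_nonneg (weight_pos _ _).le, dominant]
  have h := mul_le_mul_of_nonneg_right (sqrt_stiffSymbol_le hθ hθ' m ξ)
    (mul_nonneg (weight_pos (-1) ξ).le (norm_nonneg (q₀ ξ)))
  have e : (7 + 4 * |m|) * weight 1 ξ * (weight (-1) ξ * ‖q₀ ξ‖) =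
      (weight 1 ξ * weight (-1) ξ) * ((7 + 4 * |m|) * ‖q₀ ξ‖) := by ring
  rw [e, weight_mul_neg, one_mul] at h
  linarith

lemma norm_profile_snd_le (hθ : 0 < θ) (hθ' : θ ≤ 1) (q₀ q₁ : L2 n) {t : ℝ} (ht : 0 ≤ t)
    (ξ : Rn n) : ‖(profile θ m q₀ q₁ t ξ).2‖ ≤ dominant m q₀ q₁ ξ :=
  (norm_snd_le ht (lapSymbol_nonneg ξ) (stiffSymbol_nonneg θ m ξ) _).trans
    (data_le_dominant hθ hθ' m q₀ q₁ ξ)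

/-- The weight is at most 1 + |ξ| ≤ 1 + √c. The summand 1 is handled by `norm_fst_le`, and √c by the
energy. -/
lemma norm_profile_fst_le (hθ : 0 < θ) (hθ' : θ ≤ 1) (q₀ q₁ : L2 n) {t T : ℝ} (ht : t ∈ Icc 0 T)
    (ξ : Rn n) : ‖(weight 1 ξ : ℂ) * (profile θ m q₀ q₁ t ξ).1‖ ≤
      ‖q₀ ξ‖ + (1 + T) * dominant m q₀ q₁ ξ := by
  have hd := data_le_dominant hθ hθ' m q₀ q₁ ξ
  have h1 := (sqrt_mul_norm_fst_le ht.1 (lapSymbol_nonneg ξ) (stiffSymbol_nonneg θ m ξ)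
    ((weight (-1) ξ : ℂ) * q₀ ξ, q₁ ξ)).trans hd
  have h2 := norm_fst_le ht.1 (lapSymbol_nonneg ξ) (stiffSymbol_nonneg θ m ξ)
    ((weight (-1) ξ : ℂ) * q₀ ξ, q₁ ξ)
  have hw1 : weight (-1) ξ ≤ 1 := by
    have := one_le_weight_one ξ
    nlinarith [weight_mul_neg ξ, weight_pos (-1) ξ]
  have h3 : ‖(weight (-1) ξ : ℂ) * q₀ ξ‖ ≤ ‖q₀ ξ‖ := by
    rw [norm_mul, Complex.norm_real, Real.norm_of_nonneg (weight_pos _ _).le]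
    exact mul_le_of_le_one_left (norm_nonneg _) hw1
  have hD : 0 ≤ dominant m q₀ q₁ ξ := by unfold dominant; positivity
  have h4 : t * (‖q₁ ξ‖ + √(stiffSymbol θ m ξ) * ‖(weight (-1) ξ : ℂ) * q₀ ξ‖) ≤
      T * dominant m q₀ q₁ ξ :=
    mul_le_mul ht.2 hd (by positivity) (ht.1.trans ht.2)
  have hn : ‖ξ‖ ≤ √(stiffSymbol θ m ξ) := by
    refine Real.le_sqrt_of_sq_le ((?_ : ‖ξ‖ ^ 2 ≤ lapSymbol ξ).trans
      (lapSymbol_le_stiffSymbol θ m ξ))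
    rw [lapSymbol, mul_pow]
    have : 1 ≤ (2 * Real.pi) ^ 2 := by nlinarith [Real.pi_gt_three]
    nlinarith [sq_nonneg ‖ξ‖]
  rw [norm_mul, Complex.norm_real, Real.norm_of_nonneg (weight_pos _ _).le]
  change weight 1 ξ * ‖(phaseFlow t (lapSymbol ξ) (stiffSymbol θ m ξ)
    ((weight (-1) ξ : ℂ) * q₀ ξ, q₁ ξ)).1‖ ≤ _
  set y := ‖(phaseFlow t (lapSymbol ξ) (stiffSymbol θ m ξ)
    ((weight (-1) ξ : ℂ) * q₀ ξ, q₁ ξ)).1‖ with hy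
  have hy0 : 0 ≤ y := norm_nonneg _
  calc weight 1 ξ * y ≤ (1 + ‖ξ‖) * y := mul_le_mul_of_nonneg_right (weight_one_le ξ) hy0
    _ ≤ y + √(stiffSymbol θ m ξ) * y := by nlinarith
    _ ≤ ‖q₀ ξ‖ + (1 + T) * dominant m q₀ q₁ ξ := by linarith

/-- Weighted first component of the solution on the Fourier side. -/
def profilePos (θ m : ℝ) (q₀ q₁ : L2 n) (t : ℝ) (ξ : Rn n) : ℂ :=
  (weight 1 ξ : ℂ) * (profile θ m q₀ q₁ t ξ).1

lemma memLp_profilePos (hθ : 0 < θ) (hθ' : θ ≤ 1) (q₀ q₁ : L2 n) {t : ℝ} (ht : 0 ≤ t) :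
    MemLp (profilePos θ m q₀ q₁ t) 2 volume := by
  refine MemLp.mono' ((Lp.memLp q₀).norm.add ((memLp_dominant m q₀ q₁).const_mul (1 + t))) ?_
    (Filter.Eventually.of_forall fun ξ => norm_profile_fst_le hθ hθ' q₀ q₁ ⟨ht, le_rfl⟩ ξ)
  exact (Complex.continuous_ofReal.comp (continuous_weight 1)).aestronglyMeasurable.mul
    (aestronglyMeasurable_profile hθ q₀ q₁ t).fst

lemma memLp_profile_snd (hθ : 0 < θ) (hθ' : θ ≤ 1) (q₀ q₁ : L2 n) {t : ℝ} (ht : 0 ≤ t) :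
    MemLp (fun ξ => (profile θ m q₀ q₁ t ξ).2) 2 volume :=
  MemLp.mono' (memLp_dominant m q₀ q₁) (aestronglyMeasurable_profile hθ q₀ q₁ t).snd
    (Filter.Eventually.of_forall fun ξ => norm_profile_snd_le hθ hθ' q₀ q₁ ht ξ)

/-- The weighted position on the Fourier side as a curve in `L²` (constant for `t ≤ 0`). -/
def posCurve (hθ : 0 < θ) (hθ' : θ ≤ 1) (m : ℝ) (q₀ q₁ : L2 n) (t : ℝ) : L2 n :=
  (memLp_profilePos (m := m) hθ hθ' q₀ q₁ (le_max_right t 0)).toLp _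

/-- The velocity on the Fourier side as a curve in `L²` (constant for `t ≤ 0`). -/
def velCurve (hθ : 0 < θ) (hθ' : θ ≤ 1) (m : ℝ) (q₀ q₁ : L2 n) (t : ℝ) : L2 n :=
  (memLp_profile_snd (m := m) hθ hθ' q₀ q₁ (le_max_right t 0)).toLp _

variable (hθ : 0 < θ) (hθ' : θ ≤ 1) (m) (q₀ q₁ : L2 n)

lemma coeFn_posCurve {t : ℝ} (ht : t ≥ 0) :
    posCurve hθ hθ' m q₀ q₁ t =ᵐ[volume] profilePos θ m q₀ q₁ t := by
  refine (memLp_profilePos (m := m) hθ hθ' q₀ q₁ (le_max_right t 0)).coeFn_toLp.trans ?_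
  rw [max_eq_left ht]

lemma coeFn_velCurve {t : ℝ} (ht : t ≥ 0) :
    velCurve hθ hθ' m q₀ q₁ t =ᵐ[volume] fun ξ => (profile θ m q₀ q₁ t ξ).2 := by
  refine (memLp_profile_snd (m := m) hθ hθ' q₀ q₁ (le_max_right t 0)).coeFn_toLp.trans ?_
  rw [max_eq_left ht]

lemma coeFn_unweight_posCurve {t : ℝ} (ht : t ≥ 0) :
    unweight n (posCurve hθ hθ' m q₀ q₁ t) =ᵐ[volume] fun ξ => (profile θ m q₀ q₁ t ξ).1 := by
  filter_upwards [coeFn_unweight (posCurve hθ hθ' m q₀ q₁ t), coeFn_posCurve m hθ hθ' q₀ q₁ ht]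
    with ξ h1 h2
  rw [h1, h2, profilePos, ← mul_assoc, ← Complex.ofReal_mul, mul_comm (weight (-1) ξ),
    weight_mul_neg, Complex.ofReal_one, one_mul]

lemma posCurve_zero : posCurve hθ hθ' m q₀ q₁ 0 = q₀ := by
  apply Lp.ext
  filter_upwards [coeFn_posCurve m hθ hθ' q₀ q₁ le_rfl] with ξ h
  rw [h, profilePos, profile, phaseFlow_zero, ← mul_assoc, ← Complex.ofReal_mul, weight_mul_neg,
    Complex.ofReal_one, one_mul]

lemma velCurve_zero : velCurve hθ hθ' m q₀ q₁ 0 = q₁ := by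
  apply Lp.ext
  filter_upwards [coeFn_velCurve m hθ hθ' q₀ q₁ le_rfl] with ξ h
  rw [h, profile, phaseFlow_zero]

lemma hasDerivAt_profile_fst (t : ℝ) (ξ : Rn n) :
    HasDerivAt (fun s => (profile θ m q₀ q₁ s ξ).1) (profile θ m q₀ q₁ t ξ).2 t :=
  hasDerivAt_phaseFlow_fst _ _ _ _

lemma hasDerivAt_profile_snd (t : ℝ) (ξ : Rn n) :
    HasDerivAt (fun s => (profile θ m q₀ q₁ s ξ).2)
      (-((stiffSymbol θ m ξ : ℂ) * (profile θ m q₀ q₁ t ξ).1)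
        - (lapSymbol ξ : ℂ) * (profile θ m q₀ q₁ t ξ).2) t :=
  hasDerivAt_phaseFlow_snd _ _ _ _

lemma exists_bound_profilePos (m : ℝ) (hθ : 0 < θ) (hθ' : θ ≤ 1) (q₀ q₁ : L2 n) (T : ℝ) : ∃ g : Rn n → ℝ, MemLp g 2 volume ∧
    ∀ ξ, ∀ t ∈ Icc 0 T, ‖profilePos θ m q₀ q₁ t ξ‖ ≤ g ξ :=
  ⟨_, (Lp.memLp q₀).norm.add ((memLp_dominant m q₀ q₁).const_mul (1 + T)),
    fun ξ _ ht => norm_profile_fst_le hθ hθ' q₀ q₁ ht ξ⟩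

lemma continuousOn_posCurve : ContinuousOn (posCurve hθ hθ' m q₀ q₁) (Ici 0) := by
  refine continuousOn_L2_of_dominated (fun t ht => coeFn_posCurve m hθ hθ' q₀ q₁ ht) ?_ ?_
  · refine Filter.Eventually.of_forall fun ξ t _ => ?_
    exact ((hasDerivAt_profile_fst m q₀ q₁ t ξ).continuousAt.const_mul _).continuousWithinAt
  · intro T
    obtain ⟨g, hg, h⟩ := exists_bound_profilePos m hθ hθ' q₀ q₁ T
    exact ⟨g, hg, Filter.Eventually.of_forall h⟩

lemma continuousOn_velCurve : ContinuousOn (velCurve hθ hθ' m q₀ q₁) (Ici 0) := by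
  refine continuousOn_L2_of_dominated (fun t ht => coeFn_velCurve m hθ hθ' q₀ q₁ ht) ?_ ?_
  · refine Filter.Eventually.of_forall fun ξ t _ => ?_
    exact (hasDerivAt_profile_snd m q₀ q₁ t ξ).continuousAt.continuousWithinAt
  · intro T
    exact ⟨_, memLp_dominant m q₀ q₁, Filter.Eventually.of_forall fun ξ t ht =>
      norm_profile_snd_le hθ hθ' q₀ q₁ ht.1 ξ⟩

lemma coeFn_rhs (y v : L2 n) : rhs hθ hθ' m y v =ᵐ[volume] fun ξ => (weight (-2) ξ : ℂ) *
    (-((stiffSymbol θ m ξ : ℂ) * y ξ) - (lapSymbol ξ : ℂ) * v ξ) := by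
  filter_upwards [coeFn_mulL2 (bddSymbol_stiff hθ hθ' m) y, coeFn_mulL2 bddSymbol_lap v,
    Lp.coeFn_sub (-mulL2 (bddSymbol_stiff hθ hθ' m) y) (mulL2 bddSymbol_lap v),
    Lp.coeFn_neg (mulL2 (bddSymbol_stiff hθ hθ' m) y)] with ξ h1 h2 h3 h4
  rw [rhs, h3, Pi.sub_apply, h4, Pi.neg_apply, h1, h2]
  push_cast
  ring

/-- The frequency equations hold exactly, so only domination is at stake: y' is bounded by
`dominant`, and y'' becomes dominated once the weight (1 + |ξ|²)⁻¹ has made its two symbols bounded.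
-/
lemma fourierSolution_curve : FourierSolution hθ hθ' m
    (fun t => unweight n (posCurve hθ hθ' m q₀ q₁ t)) (velCurve hθ hθ' m q₀ q₁) where
  continuousOn_vel := continuousOn_velCurve m hθ hθ' q₀ q₁
  deriv_pos t ht := by
    refine hasDerivWithinAt_L2_of_dominated
      (fun t ht => coeFn_unweight_posCurve m hθ hθ' q₀ q₁ ht)
      (fun t ht => coeFn_velCurve m hθ hθ' q₀ q₁ ht) ?_ ?_ ht
    · exact Filter.Eventually.of_forall fun ξ t _ =>
        (hasDerivAt_profile_fst m q₀ q₁ t ξ).hasDerivWithinAt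
    · intro T
      exact ⟨_, memLp_dominant m q₀ q₁, Filter.Eventually.of_forall fun ξ t ht =>
        norm_profile_snd_le hθ hθ' q₀ q₁ ht.1 ξ⟩
  deriv_vel t ht := by
    refine hasDerivWithinAt_L2_of_dominated
      (F := fun t ξ => (weight (-2) ξ : ℂ) * (profile θ m q₀ q₁ t ξ).2)
      (G := fun t ξ => (weight (-2) ξ : ℂ) * (-((stiffSymbol θ m ξ : ℂ) *
        (profile θ m q₀ q₁ t ξ).1) - (lapSymbol ξ : ℂ) * (profile θ m q₀ q₁ t ξ).2))
      (f' := fun t => rhs hθ hθ' m (unweight n (posCurve hθ hθ' m q₀ q₁ t))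
        (velCurve hθ hθ' m q₀ q₁ t)) ?_ ?_ ?_ ?_ ht
    · intro t ht
      filter_upwards [coeFn_mulL2 (bddSymbol_weight (s := -2) (by norm_num))
        (velCurve hθ hθ' m q₀ q₁ t), coeFn_velCurve m hθ hθ' q₀ q₁ ht] with ξ h1 h2
      rw [smoothing, h1, h2]
    · intro t ht
      filter_upwards [coeFn_rhs m hθ hθ' (unweight n (posCurve hθ hθ' m q₀ q₁ t))
        (velCurve hθ hθ' m q₀ q₁ t), coeFn_unweight_posCurve m hθ hθ' q₀ q₁ ht,
        coeFn_velCurve m hθ hθ' q₀ q₁ ht] with ξ h1 h2 h3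
      rw [h1, h2, h3]
    · exact Filter.Eventually.of_forall fun ξ t _ =>
        ((hasDerivAt_profile_snd m q₀ q₁ t ξ).const_mul _).hasDerivWithinAt
    · intro T
      obtain ⟨g, hg, hb⟩ := exists_bound_profilePos m hθ hθ' q₀ q₁ T
      obtain ⟨C₁, hC₁⟩ := (bddSymbol_stiff (n := n) hθ hθ' m).bounded
      obtain ⟨C₂, hC₂⟩ := (bddSymbol_lap (n := n)).bounded
      refine ⟨_, (hg.const_mul C₁).add ((memLp_dominant m q₀ q₁).const_mul C₂),
        Filter.Eventually.of_forall fun ξ t ht => ?_⟩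
      have e : (weight (-2) ξ : ℂ) * (-((stiffSymbol θ m ξ : ℂ) * (profile θ m q₀ q₁ t ξ).1)
          - (lapSymbol ξ : ℂ) * (profile θ m q₀ q₁ t ξ).2) =
        -(((weight (-2) ξ * stiffSymbol θ m ξ : ℝ) : ℂ) * (profile θ m q₀ q₁ t ξ).1)
          - ((weight (-2) ξ * lapSymbol ξ : ℝ) : ℂ) * (profile θ m q₀ q₁ t ξ).2 := by
        push_cast; ring
      have h1 : ‖(profile θ m q₀ q₁ t ξ).1‖ ≤ g ξ := by
        refine le_trans ?_ (hb ξ t ht)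
        rw [profilePos, norm_mul, Complex.norm_real, Real.norm_of_nonneg (weight_pos _ _).le]
        exact le_mul_of_one_le_left (norm_nonneg _) (one_le_weight_one ξ)
      have h2 := norm_profile_snd_le (m := m) hθ hθ' q₀ q₁ ht.1 ξ
      rw [e]
      refine (norm_sub_le _ _).trans ?_
      rw [norm_neg, norm_mul, norm_mul, Complex.norm_real, Complex.norm_real]
      exact add_le_add
        (mul_le_mul (hC₁ ξ) h1 (norm_nonneg _) ((abs_nonneg _).trans (hC₁ ξ)))
        (mul_le_mul (hC₂ ξ) h2 (norm_nonneg _) ((abs_nonneg _).trans (hC₂ ξ)))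

/-- For regular data, the time derivative solves the equation with the differentiated data. -/
lemma profile_eq_phaseGen {r₁ s₁ : L2 n}
    (hr : q₁ =ᵐ[volume] fun ξ => (weight (-1) ξ : ℂ) * r₁ ξ)
    (hs : s₁ =ᵐ[volume] fun ξ => -((stiffSymbol θ m ξ : ℂ) * ((weight (-1) ξ : ℂ) * q₀ ξ))
      - (lapSymbol ξ : ℂ) * q₁ ξ) :
    ∀ᵐ ξ, ∀ t, profile θ m r₁ s₁ t ξ =
      phaseGen (lapSymbol ξ) (stiffSymbol θ m ξ) (profile θ m q₀ q₁ t ξ) := by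
  filter_upwards [hr, hs] with ξ h1 h2 t
  rw [profile, profile, ← phaseFlow_phaseGen, phaseGen_apply]
  simp only
  rw [h2, ← h1]

/-- Here `r₁` is the weighted transform of u₁ and `s₁` the transform of the initial acceleration.
With these as data, the derivative obeys the same bounds as a position, which gives
differentiability in the H¹ norm. -/
lemma hasDerivWithinAt_posCurve {r₁ s₁ : L2 n}
    (hr : q₁ =ᵐ[volume] fun ξ => (weight (-1) ξ : ℂ) * r₁ ξ)
    (hs : s₁ =ᵐ[volume] fun ξ => -((stiffSymbol θ m ξ : ℂ) * ((weight (-1) ξ : ℂ) * q₀ ξ))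
      - (lapSymbol ξ : ℂ) * q₁ ξ) {t : ℝ} (ht : 0 ≤ t) :
    HasDerivWithinAt (posCurve hθ hθ' m q₀ q₁) (posCurve hθ hθ' m r₁ s₁ t) (Ici 0) t := by
  have hp := profile_eq_phaseGen m q₀ q₁ hr hs
  refine hasDerivWithinAt_L2_of_dominated (fun t ht => coeFn_posCurve m hθ hθ' q₀ q₁ ht)
    (fun t ht => coeFn_posCurve m hθ hθ' r₁ s₁ ht) ?_ ?_ ht
  · filter_upwards [hp] with ξ h t _
    have e : profilePos θ m r₁ s₁ t ξ = (weight 1 ξ : ℂ) * (profile θ m q₀ q₁ t ξ).2 := by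
      rw [profilePos, h t, phaseGen_apply]
    rw [e]
    exact ((hasDerivAt_profile_fst m q₀ q₁ t ξ).const_mul _).hasDerivWithinAt
  · intro T
    obtain ⟨g, hg, h⟩ := exists_bound_profilePos m hθ hθ' r₁ s₁ T
    exact ⟨g, hg, Filter.Eventually.of_forall h⟩

lemma velCurve_eq {r₁ s₁ : L2 n}
    (hr : q₁ =ᵐ[volume] fun ξ => (weight (-1) ξ : ℂ) * r₁ ξ)
    (hs : s₁ =ᵐ[volume] fun ξ => -((stiffSymbol θ m ξ : ℂ) * ((weight (-1) ξ : ℂ) * q₀ ξ))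
      - (lapSymbol ξ : ℂ) * q₁ ξ) {t : ℝ} (ht : 0 ≤ t) :
    velCurve hθ hθ' m q₀ q₁ t = unweight n (posCurve hθ hθ' m r₁ s₁ t) := by
  apply Lp.ext
  filter_upwards [coeFn_velCurve m hθ hθ' q₀ q₁ ht, coeFn_unweight_posCurve m hθ hθ' r₁ s₁ ht,
    profile_eq_phaseGen m q₀ q₁ hr hs] with ξ h1 h2 h3
  rw [h1, h2, h3, phaseGen_apply]

/-! ### Existence -/

/-- The solution with the given data on the Fourier side. -/
def solutionCurve (t : ℝ) : H1 n := (hatH1 n).symm (posCurve hθ hθ' m q₀ q₁ t)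

lemma fourier_solutionCurve (t : ℝ) : (𝓕 (solutionCurve m hθ hθ' q₀ q₁ t).toL2 : L2 n) =
    unweight n (posCurve hθ hθ' m q₀ q₁ t) := by
  rw [fourier_toL2, solutionCurve, LinearIsometryEquiv.apply_symm_apply]

lemma toL2_solutionCurve (t : ℝ) : (solutionCurve m hθ hθ' q₀ q₁ t).toL2 =
    (fourierL2 n).symm (unweight n (posCurve hθ hθ' m q₀ q₁ t)) := by
  rw [toL2_eq, solutionCurve, LinearIsometryEquiv.apply_symm_apply]

lemma hasDerivWithinAt_solutionCurve {t : ℝ} (ht : 0 ≤ t) :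
    HasDerivWithinAt (fun s => (solutionCurve m hθ hθ' q₀ q₁ s).toL2)
      ((fourierL2 n).symm (velCurve hθ hθ' m q₀ q₁ t)) (Ici 0) t := by
  simp only [toL2_solutionCurve]
  exact hasDerivWithinAt_map (fourierL2 n).symm.toContinuousLinearEquiv.toContinuousLinearMap
    ((fourierSolution_curve m hθ hθ' q₀ q₁).deriv_pos t ht)

lemma vel_solutionCurve {t : ℝ} (ht : 0 ≤ t) : vel (solutionCurve m hθ hθ' q₀ q₁) t =
    (fourierL2 n).symm (velCurve hθ hθ' m q₀ q₁ t) :=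
  vel_eq_of_hasDerivWithinAt ht (hasDerivWithinAt_solutionCurve m hθ hθ' q₀ q₁ ht)

lemma contDiffOn_one_of_hasDerivWithinAt {E : Type*} [NormedAddCommGroup E] [NormedSpace ℝ E]
    {f f' : ℝ → E} (h : ∀ t ≥ 0, HasDerivWithinAt f (f' t) (Ici 0) t)
    (hc : ContinuousOn f' (Ici 0)) : ContDiffOn ℝ 1 f (Ici 0) := by
  rw [contDiffOn_one_iff_derivWithin (uniqueDiffOn_Ici 0)]
  refine ⟨fun t ht => (h t ht).differentiableWithinAt, hc.congr fun t ht => ?_⟩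
  exact (h t ht).derivWithin (uniqueDiffOn_Ici 0 t ht)

lemma weakClass_solutionCurve : WeakClass (solutionCurve m hθ hθ' q₀ q₁) where
  continuousOn_H1 :=
    (hatH1 n).symm.continuous.comp_continuousOn (continuousOn_posCurve m hθ hθ' q₀ q₁)
  contDiffOn_L2 := contDiffOn_one_of_hasDerivWithinAt
    (fun _ ht => hasDerivWithinAt_solutionCurve m hθ hθ' q₀ q₁ ht)
    ((fourierL2 n).symm.continuous.comp_continuousOn (continuousOn_velCurve m hθ hθ' q₀ q₁))

lemma isWeakSolution_solutionCurve : IsWeakSolution θ m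
    ((fourierL2 n).symm (unweight n q₀)) ((fourierL2 n).symm q₁)
    (solutionCurve m hθ hθ' q₀ q₁) := by
  have hw := weakClass_solutionCurve m hθ hθ' q₀ q₁
  have hs := fourierSolution_curve m hθ hθ' q₀ q₁
  have hv : ∀ t ≥ 0, (𝓕 (vel (solutionCurve m hθ hθ' q₀ q₁) t) : L2 n) =
      velCurve hθ hθ' m q₀ q₁ t := fun t ht => by
    rw [vel_solutionCurve m hθ hθ' q₀ q₁ ht]
    exact (fourierL2 n).apply_symm_apply _
  refine IsWeakSolution.of_fourierSolution hθ hθ' ?_ ?_ ⟨?_, fun t ht => ?_, fun t ht => ?_⟩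
  · rw [toL2_solutionCurve, posCurve_zero]
  · rw [vel_solutionCurve m hθ hθ' q₀ q₁ le_rfl, velCurve_zero]
  · exact hs.continuousOn_vel.congr hv
  · simp only [fourier_solutionCurve]
    rw [hv t ht]
    exact hs.deriv_pos t ht
  · simp only [fourier_solutionCurve]
    rw [hv t ht]
    exact (hs.deriv_vel t ht).congr (fun s hs => by rw [hv s hs]) (by rw [hv t ht])

/-- The velocity is itself a solution curve, with data (`r₁`, `s₁`); being of the weak class, it is
continuous into `H1 n` and continuously differentiable into `L2 n`. -/
lemma strongClass_solutionCurve {r₁ s₁ : L2 n}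
    (hr : q₁ =ᵐ[volume] fun ξ => (weight (-1) ξ : ℂ) * r₁ ξ)
    (hs : s₁ =ᵐ[volume] fun ξ => -((stiffSymbol θ m ξ : ℂ) * ((weight (-1) ξ : ℂ) * q₀ ξ))
      - (lapSymbol ξ : ℂ) * q₁ ξ) : StrongClass (solutionCurve m hθ hθ' q₀ q₁) where
  contDiffOn_H1 := contDiffOn_one_of_hasDerivWithinAt
    (f' := fun t => (hatH1 n).symm (posCurve hθ hθ' m r₁ s₁ t))
    (fun _ ht => hasDerivWithinAt_map
      (hatH1 n).symm.toContinuousLinearEquiv.toContinuousLinearMap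
      (hasDerivWithinAt_posCurve m hθ hθ' q₀ q₁ hr hs ht))
    ((hatH1 n).symm.continuous.comp_continuousOn (continuousOn_posCurve m hθ hθ' r₁ s₁))
  contDiffOn_L2 := by
    have h2 : ContDiffOn ℝ (1 + 1) (fun t => (solutionCurve m hθ hθ' q₀ q₁ t).toL2) (Ici 0) := by
      rw [contDiffOn_succ_iff_derivWithin (uniqueDiffOn_Ici 0)]
      refine ⟨fun t ht =>
        (hasDerivWithinAt_solutionCurve m hθ hθ' q₀ q₁ ht).differentiableWithinAt, by simp, ?_⟩
      refine (contDiffOn_one_of_hasDerivWithinAt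
        (fun _ ht => hasDerivWithinAt_solutionCurve m hθ hθ' r₁ s₁ ht)
        ((fourierL2 n).symm.continuous.comp_continuousOn
          (continuousOn_velCurve m hθ hθ' r₁ s₁))).congr fun t ht => ?_
      change vel (solutionCurve m hθ hθ' q₀ q₁) t = _
      rw [vel_solutionCurve m hθ hθ' q₀ q₁ ht, velCurve_eq m hθ hθ' q₀ q₁ hr hs ht,
        toL2_solutionCurve]
    convert h2 using 1; norm_num

/-- The weighted Fourier transform of an element of `H¹` recovers the element. -/
lemma fourier_symm_unweight {f g : L2 n}
    (hg : g =ᵐ[volume] fun ξ => (weight 1 ξ : ℂ) * (𝓕 f : L2 n) ξ) :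
    (fourierL2 n).symm (unweight n g) = f := by
  rw [LinearIsometryEquiv.symm_apply_eq]
  apply Lp.ext
  filter_upwards [coeFn_unweight g, hg] with ξ h1 h2
  rw [h1, h2, fourierL2_apply, ← mul_assoc, ← Complex.ofReal_mul, mul_comm (weight (-1) ξ),
    weight_mul_neg, Complex.ofReal_one, one_mul]

theorem exists_weakSolution (m : ℝ) (hθ : 0 < θ) (hθ' : θ ≤ 1) {u₀ u₁ : L2 n} (h₀ : u₀ ∈ sobolev n 1) :
    ∃ u : ℝ → H1 n, WeakClass u ∧ IsWeakSolution θ m u₀ u₁ u := by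
  obtain ⟨q₀, hq₀⟩ := (mem_sobolev_iff 1 u₀).1 h₀
  refine ⟨solutionCurve m hθ hθ' q₀ (𝓕 u₁), weakClass_solutionCurve _ _ _ _ _, ?_⟩
  have h := isWeakSolution_solutionCurve m hθ hθ' q₀ (𝓕 u₁)
  rwa [fourier_symm_unweight hq₀, ← fourierL2_apply, LinearIsometryEquiv.symm_apply_apply] at h

theorem exists_solution (m : ℝ) (hθ : 0 < θ) (hθ' : θ ≤ 1) {u₀ u₁ : L2 n} (h : (u₀, u₁) ∈ domainB n) :
    ∃ u : ℝ → H1 n, StrongClass u ∧ IsSolution θ m u₀ u₁ u := by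
  obtain ⟨h₀, h₁, h₂⟩ := h
  obtain ⟨q₀, hq₀⟩ := (mem_sobolev_iff 1 u₀).1 h₀
  obtain ⟨r₁, hr₁⟩ := (mem_sobolev_iff 1 u₁).1 h₁
  obtain ⟨g₂, hg₂⟩ := (mem_sobolev_iff 2 (u₀ + u₁)).1 h₂
  have hadd : (𝓕 (u₀ + u₁) : L2 n) = 𝓕 u₀ + 𝓕 u₁ := FourierTransform.fourier_add _ _
  rw [hadd] at hg₂
  -- The initial acceleration, grouped so that the Laplacian acts on u₀ + u₁ in H² and
  -- `logLaplacian` on u₀ in H¹. The separate terms Δu₀ and Δu₁ need not be in `L2 n`.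
  set s₁ : L2 n := -mulL2 bddSymbol_lap g₂
    - ((m : ℂ) ^ 2) • mulL2 (bddSymbol_log_rel hθ hθ') q₀ with hs₁
  have hr : (𝓕 u₁ : L2 n) =ᵐ[volume] fun ξ => (weight (-1) ξ : ℂ) * r₁ ξ := by
    filter_upwards [hr₁] with ξ h1
    rw [h1, ← mul_assoc, ← Complex.ofReal_mul, mul_comm (weight (-1) ξ),
      weight_mul_neg, Complex.ofReal_one, one_mul]
  have hs : s₁ =ᵐ[volume] fun ξ => -((stiffSymbol θ m ξ : ℂ) * ((weight (-1) ξ : ℂ) * q₀ ξ))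
      - (lapSymbol ξ : ℂ) * (𝓕 u₁ : L2 n) ξ := by
    filter_upwards [hg₂, hq₀, coeFn_mulL2 bddSymbol_lap g₂,
      coeFn_mulL2 (bddSymbol_log_rel hθ hθ') q₀,
      Lp.coeFn_sub (-mulL2 bddSymbol_lap g₂)
        (((m : ℂ) ^ 2) • mulL2 (bddSymbol_log_rel hθ hθ') q₀),
      Lp.coeFn_neg (mulL2 bddSymbol_lap g₂),
      Lp.coeFn_smul ((m : ℂ) ^ 2) (mulL2 (bddSymbol_log_rel hθ hθ') q₀),
      Lp.coeFn_add (𝓕 u₀ : L2 n) (𝓕 u₁)] with ξ e1 e2 e3 e4 e5 e6 e7 e8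
    have w2 : (weight 2 ξ : ℂ) * (weight (-2) ξ : ℂ) = 1 := by
      rw [← Complex.ofReal_mul, weight_two_mul_neg, Complex.ofReal_one]
    have w1 : (weight 1 ξ : ℂ) * (weight (-1) ξ : ℂ) = 1 := by
      rw [← Complex.ofReal_mul, weight_mul_neg, Complex.ofReal_one]
    rw [hs₁, e5, Pi.sub_apply, e6, Pi.neg_apply, e7, Pi.smul_apply, e3, e4, e1, e2, e8,
      Pi.add_apply, stiffSymbol, smul_eq_mul]
    push_cast
    linear_combination (-(lapSymbol ξ : ℂ) * ((𝓕 u₀ : L2 n) ξ + (𝓕 u₁ : L2 n) ξ)) * w2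
      + ((lapSymbol ξ : ℂ) * (𝓕 u₀ : L2 n) ξ) * w1
  have hst := strongClass_solutionCurve m hθ hθ' q₀ (𝓕 u₁) hr hs
  refine ⟨solutionCurve m hθ hθ' q₀ (𝓕 u₁), hst, hst.isSolution_iff.2 ?_⟩
  have h := isWeakSolution_solutionCurve m hθ hθ' q₀ (𝓕 u₁)
  rwa [fourier_symm_unweight hq₀, ← fourierL2_apply, LinearIsometryEquiv.symm_apply_apply] at h

end Existence

end LogWave

end

theorem theorem3p3 (n : ℕ) (hn : 1 ≤ n) (θ m : ℝ) (hθ : 0 < θ) (hθ' : θ ≤ 1) (hm : 0 < m) :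
    (∀ u₀ u₁ : L2 n, (u₀, u₁) ∈ domainB n →
      ∃ u : ℝ → H1 n, (StrongClass u ∧ IsSolution θ m u₀ u₁ u) ∧
        ∀ w : ℝ → H1 n, StrongClass w ∧ IsSolution θ m u₀ u₁ w → EqOn w u (Ici 0)) ∧
    (∀ u₀ u₁ : L2 n, u₀ ∈ sobolev n 1 →
      ∃ u : ℝ → H1 n, (WeakClass u ∧ IsWeakSolution θ m u₀ u₁ u) ∧
        ∀ w : ℝ → H1 n, WeakClass w ∧ IsWeakSolution θ m u₀ u₁ w → EqOn w u (Ici 0)) := by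
  constructor
  · intro u₀ u₁ h
    obtain ⟨u, hu, hu'⟩ := exists_solution m hθ hθ' h
    exact ⟨u, ⟨hu, hu'⟩, fun w hw => weakSolution_unique hθ hθ' hu.weakClass
      (hu.isSolution_iff.1 hu') hw.1.weakClass (hw.1.isSolution_iff.1 hw.2)⟩
  · intro u₀ u₁ h
    obtain ⟨u, hu, hu'⟩ := exists_weakSolution m hθ hθ' (u₁ := u₁) h
    exact ⟨u, ⟨hu, hu'⟩, fun w hw => weakSolution_unique hθ hθ' hu hu' hw.1 hw.2⟩
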